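/- \textbf{Setting.} Let $S$ be a compact Polish space and $(V_t)_{t\ge0}$ a càdlàg Feller (Markov) process on $S$ with respect to a right-continuous filtration $(\mathcal F_t)$, with laws $(\mathbb P_x)_{x\in S}$, $\mathbb P_x(V_0=x)=1$, and $\mathbb P_\nu=\int\mathbb P_y\,\nu(\mathrm dy)$. Assume that $(V_t)$ has a unique invariant probability measure $\pi$, and that there are constants $C_0,\delta>0$ such that for every $x\in S$ one can define on a common probability space $(\tilde\Omega,\tilde{\mathcal F},\tilde{\mathbb P})$ càdlàg processes $V^x$ and $V^\pi$, with the finite-dimensional distributions of $V$ under $\mathbb P_x$ and under $\mathbb P_\pi$ respectively, for which $T^x=\inf\{t\ge0: V^x_t=V^\pi_t\}$ is a stopping time and $\tilde{\mathbb P}(T^x\ge t)\le C_0e^{-\delta t}$ for all $t\ge0$. Let $f:\mathbb R^K\times S\to\mathbb R$ be continuous and $C^2$ in $\theta$, with $\nabla_\theta f$ and the Hessian $H_\theta f$ continuous on $\mathbb R^K\times S$, $\nabla_\theta f(\cdot,y)$ Lipschitz uniformly in $y$, and $f(\theta,\cdot),\nabla_\theta f(\theta,\cdot)$ $\pi$-integrable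 for every $\theta$. Assume uniform strong convexity: there is $\kappa>0$ with $\langle x_1-x_2,\nabla_\theta f(x_1,y)-\nabla_\theta f(x_2,y)\rangle\ge\kappa\|x_1-x_2\|^2$ for all $x_1,x_2\in\mathbb R^K$, $y\in S$. Put $\Phi(\theta)=\int_S f(\theta,y)\,\pi(\mathrm dy)$, and let $$\mathcal W_d(\nu,\nu')=\inf_\Gamma\int (1\wedge\|y-y'\|)\,\Gamma(\mathrm dy,\mathrm dy'),$$ the infimum being over all couplings $\Gamma$ of the probability measures $\nu,\nu'$ on $\mathbb R^K$. For $\varepsilon>0$, the constant-rate process is the solution of $\mathrm d\theta^\varepsilon_t=-\nabla_\theta f(\theta^\varepsilon_t,V_{t/\varepsilon})\,\mathrm dt$. For a function $\mu:[0,\infty)\to(0,\infty)$, the decreasing-rate process (SGPD) started at $\theta_0\in\mathbb R^K$ is the solution of $\mathrm d\xi_t=-\nabla_\theta f(\xi_t,V_{\beta(t)})\,\mathrm dt$, $\xi_0=\theta_0$, where $\beta(t)=\int_0^t\mu(s)\,\mathrm ds$; its law at time $t$ is denoted $D_t(\cdot|\theta_0,\pi)$ under $\mathbb P_\pi$ and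 $D_t(\cdot|\theta_0,a)$ under $\mathbb P_a$, $a\in S$. \textbf{Theorem.} $\Phi$ has a unique minimizer $\theta_*$. There is a function $\rho:(0,1)\to[0,1]$ with $\lim_{\varepsilon\to0}\rho(\varepsilon)=0$, depending only on $f$ and the index process, such that $\mathcal W_d(\Pi^\varepsilon(\cdot\times S),\delta_{\theta_*})\le\rho(\varepsilon)$ for every $\varepsilon\in(0,1)$ and every stationary probability measure $\Pi^\varepsilon$ of $(\theta^\varepsilon_t,V_{t/\varepsilon})_{t\ge0}$, and such that the following holds. Let $\mu:[0,\infty)\to(0,\infty)$ be non-decreasing and continuously differentiable with $\mu(t)\to\infty$ and $\mu'(t)t/\mu(t)\to0$ as $t\to\infty$, and put $$A(t)=\exp\Big(-\frac{\kappa t}{8}\Big)+\Big[\frac{\mu(t)-\mu(t/2)}{\mu(t)}\Big]^{1/2}+\rho\Big(\frac1{\mu(t/2)}\Big),$$ which is defined for all large $t$. Then $\lim_{t\to\infty}A(t)=0$, and for every $\theta_0\in\mathbb R^K$ there is a constant $C>0$ (depending on $f$, the index process, $\theta_0$ and $\mu$, but not on $a$ or $t$) such that for every $a\in S$ there is $T>0$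 with $$\mathcal W_d\big(D_t(\cdot|\theta_0,\pi),\delta_{\theta_*}\big)\le C\,A(t),\qquad \mathcal W_d\big(D_t(\cdot|\theta_0,a),\delta_{\theta_*}\big)\le C\,A(t)\qquad\text{for all }t>T.$$ -/

import Mathlib

open MeasureTheory ProbabilityTheory Filter Topology
open scoped NNReal ENNReal

universe u v w

noncomputable section

namespace SGP

/-- Right-continuous paths with left limits on `[0, ∞)`. -/
def IsCadlag {S : Type*} [TopologicalSpace S] (w : ℝ≥0 → S) : Prop :=
  ∀ t, ContinuousWithinAt w (Set.Ici t) t ∧ ∃ l, Tendsto w (𝓝[<] t) (𝓝 l)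

/-- `(V_t)` is a càdlàg Feller process with respect to the right-continuous filtration `𝓕`, under
the family of laws `(P x)`, where `P x` is the law of the process started in `x`: it is adapted,
starts in `x`, has the homogeneous Markov property with respect to `𝓕`, and its transition
operators `h ↦ E_x[h(V_t)]` preserve continuity. (Strong continuity at `t = 0` follows from the
right-continuity of the paths.) Taking for `Ω` the càdlàg path space and for `V` the coordinate
process gives the canonical setting. -/
structure IsFellerProcess {S Ω : Type*} [TopologicalSpace S] [MeasurableSpace S]
    [mΩ : MeasurableSpace Ω] (𝓕 : Filtration ℝ≥0 mΩ) (P : Kernel S Ω) (V : ℝ≥0 → Ω → S) :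
    Prop where
  rightCont : 𝓕.IsRightContinuous
  isProb : IsMarkovKernel P
  adapted : ∀ t, Measurable[𝓕 t] (V t)
  cadlag : ∀ ω, IsCadlag fun t => V t ω
  start : ∀ x, P x {ω | V 0 ω = x} = 1
  markov : ∀ (x : S) (s t : ℝ≥0) (A : Set S), MeasurableSet A →
    (P x)[(V (s + t) ⁻¹' A).indicator (fun _ => (1 : ℝ)) | 𝓕 s]
      =ᵐ[P x] fun ω => (P (V s ω)).real (V t ⁻¹' A)
  feller : ∀ (t : ℝ≥0) (h : C(S, ℝ)), Continuous fun x => ∫ ω, h (V t ω) ∂(P x)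

/-- The law `P_ν = ∫ P_y ν(dy)` of the process with initial distribution `ν`. -/
def lawFrom {S Ω : Type*} [MeasurableSpace S] [MeasurableSpace Ω] (P : Kernel S Ω)
    (ν : Measure S) : Measure Ω :=
  ν.bind P

/-- The probability measure `ν` is invariant for the process: `P_ν(V_t ∈ ·) = ν` for all `t`. -/
def IsInvariantFor {S Ω : Type*} [MeasurableSpace S] [MeasurableSpace Ω] (P : Kernel S Ω)
    (V : ℝ≥0 → Ω → S) (ν : Measure S) : Prop :=
  IsProbabilityMeasure ν ∧ ∀ t, (lawFrom P ν).map (V t) = ν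

/-- Equality in law of two processes, in the sense of finite-dimensional distributions. -/
def SameFDD {S Ω Ω' : Type*} [MeasurableSpace S] [MeasurableSpace Ω] [MeasurableSpace Ω']
    (Q : Measure Ω) (V : ℝ≥0 → Ω → S) (Q' : Measure Ω') (V' : ℝ≥0 → Ω' → S) : Prop :=
  ∀ (n : ℕ) (t : Fin n → ℝ≥0) (A : Fin n → Set S), StrictMono t → (∀ i, MeasurableSet (A i)) →
    Q {ω | ∀ i, V (t i) ω ∈ A i} = Q' {ω | ∀ i, V' (t i) ω ∈ A i}

/-- First meeting time `inf {t ≥ 0 | X_t = Y_t}` of two processes (`∞` if they never meet). -/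
def meetingTime {S Ω : Type*} (X Y : ℝ≥0 → Ω → S) (ω : Ω) : ℝ≥0∞ :=
  ⨅ (t : ℝ≥0) (_ : X t ω = Y t ω), (t : ℝ≥0∞)

/-- The standing assumption on the index process: it is Feller, `π` is its unique invariant
measure, and for each `x` a copy started in `x` and a stationary copy can be realized on a common
probability space so that their meeting time is a stopping time with an exponential tail, uniformly
in `x`. -/
structure IndexProcessAssumption {S : Type u} {Ω : Type v} [TopologicalSpace S]
    [MeasurableSpace S] [mΩ : MeasurableSpace Ω] (𝓕 : Filtration ℝ≥0 mΩ) (P : Kernel S Ω)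
    (V : ℝ≥0 → Ω → S) (π : Measure S) : Prop where
  feller : IsFellerProcess 𝓕 P V
  invariant : IsInvariantFor P V π
  unique : ∀ ν : Measure S, IsInvariantFor P V ν → ν = π
  coupling : ∃ C > (0 : ℝ), ∃ δ > (0 : ℝ), ∀ x : S,
    ∃ (Ω' : Type w) (mΩ' : MeasurableSpace Ω') (Q : Measure Ω') (𝓖 : Filtration ℝ≥0 mΩ')
      (X Y : ℝ≥0 → Ω' → S),
      IsProbabilityMeasure Q ∧
      (∀ t, Measurable[𝓖 t] (X t)) ∧ (∀ t, Measurable[𝓖 t] (Y t)) ∧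
      (∀ ω, IsCadlag fun t => X t ω) ∧ (∀ ω, IsCadlag fun t => Y t ω) ∧
      SameFDD Q X (P x) V ∧ SameFDD Q Y (lawFrom P π) V ∧
      IsStoppingTime 𝓖 (meetingTime X Y) ∧
      ∀ t : ℝ≥0, Q {ω | (t : ℝ≥0∞) ≤ meetingTime X Y ω} ≤ ENNReal.ofReal (C * Real.exp (-δ * t))

/-- The gradient `∇_θ f(θ, y)` in the first variable. -/
def gradθ {S : Type*} {K : ℕ} (f : EuclideanSpace ℝ (Fin K) → S → ℝ)
    (θ : EuclideanSpace ℝ (Fin K)) (y : S) : EuclideanSpace ℝ (Fin K) :=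
  gradient (fun z => f z y) θ

/-- Regularity of the subsampled target function: `f` is continuous and twice continuously
differentiable in `θ`, with `∇_θ f` and the Hessian jointly continuous in `(θ, y)`; `∇_θ f` is
Lipschitz in `θ` uniformly in `y`; `f(θ, ·)` and `∇_θ f(θ, ·)` are `π`-integrable. -/
structure TargetAssumption {S : Type*} [TopologicalSpace S] [MeasurableSpace S] {K : ℕ}
    (f : EuclideanSpace ℝ (Fin K) → S → ℝ) (π : Measure S) : Prop where
  cont : Continuous fun p : EuclideanSpace ℝ (Fin K) × S => f p.1 p.2
  contDiff : ∀ y, ContDiff ℝ 2 fun θ => f θ y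
  cont_grad : Continuous fun p : EuclideanSpace ℝ (Fin K) × S => gradθ f p.1 p.2
  cont_hess : Continuous fun p : EuclideanSpace ℝ (Fin K) × S =>
    fderiv ℝ (fun θ => gradθ f θ p.2) p.1
  lipschitz : ∃ L : ℝ≥0, ∀ y, LipschitzWith L fun θ => gradθ f θ y
  integrable : ∀ θ, Integrable (f θ) π
  integrable_grad : ∀ θ, Integrable (gradθ f θ) π

/-- Strong convexity of `f(·, y)` with a parameter `κ` that does not depend on `y`. -/
def UniformlyStronglyConvex {S : Type*} {K : ℕ} (f : EuclideanSpace ℝ (Fin K) → S → ℝ)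
    (κ : ℝ) : Prop :=
  ∀ (y : S) (x₁ x₂ : EuclideanSpace ℝ (Fin K)),
    κ * ‖x₁ - x₂‖ ^ 2 ≤ inner ℝ (x₁ - x₂) (gradθ f x₁ y - gradθ f x₂ y)

/-- The full target function `Φ(θ) = ∫ f(θ, y) π(dy)`. -/
def fullTarget {S : Type*} [MeasurableSpace S] {K : ℕ} (f : EuclideanSpace ℝ (Fin K) → S → ℝ)
    (π : Measure S) (θ : EuclideanSpace ℝ (Fin K)) : ℝ :=
  ∫ y, f θ y ∂π

/-- Assumption on the rate function `μ : [0, ∞) → (0, ∞)` (values at negative arguments are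
irrelevant). -/
structure RateAssumption (μ : ℝ → ℝ) : Prop where
  pos : ∀ t, 0 ≤ t → 0 < μ t
  mono : MonotoneOn μ (Set.Ici 0)
  contDiff : ContDiffOn ℝ 1 μ (Set.Ici 0)
  tendsto : Tendsto μ atTop atTop
  slow : Tendsto (fun t => derivWithin μ (Set.Ici 0) t * t / μ t) atTop (𝓝 0)

/-- The rescaled time `β(t) = ∫₀ᵗ μ(s) ds`. -/
def rescaledTime (μ : ℝ → ℝ) (t : ℝ≥0) : ℝ≥0 :=
  (∫ s in (0 : ℝ)..t, μ s).toNNReal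

/-- `ξ` is a (strong) solution of `dξ_t = -∇_θ f(ξ_t, V_{τ(t)}) dt`, `ξ_0 = θ₀`, where `τ` is a
time change: it has continuous paths, satisfies the integrated equation and `ξ_t` is measurable
with respect to `𝓕_{τ(t)}`. -/
structure IsGradientProcess {S Ω : Type*} [mΩ : MeasurableSpace Ω] {K : ℕ}
    (𝓕 : Filtration ℝ≥0 mΩ) (V : ℝ≥0 → Ω → S) (f : EuclideanSpace ℝ (Fin K) → S → ℝ)
    (τ : ℝ≥0 → ℝ≥0) (θ₀ : EuclideanSpace ℝ (Fin K)) (ξ : ℝ≥0 → Ω → EuclideanSpace ℝ (Fin K)) :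
    Prop where
  adapted : ∀ t, Measurable[𝓕 (τ t)] (ξ t)
  cont : ∀ ω, Continuous fun t => ξ t ω
  eqn : ∀ ω (t : ℝ≥0),
    ξ t ω = θ₀ - ∫ s in (0 : ℝ)..t, gradθ f (ξ s.toNNReal ω) (V (τ s.toNNReal) ω)

/-- Stochastic gradient process with constant learning rate: index process `V_{t/ε}`. -/
def IsSGPC {S Ω : Type*} [mΩ : MeasurableSpace Ω] {K : ℕ} (𝓕 : Filtration ℝ≥0 mΩ)
    (V : ℝ≥0 → Ω → S) (f : EuclideanSpace ℝ (Fin K) → S → ℝ) (ε : ℝ)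
    (θ₀ : EuclideanSpace ℝ (Fin K)) (θ : ℝ≥0 → Ω → EuclideanSpace ℝ (Fin K)) : Prop :=
  IsGradientProcess 𝓕 V f (fun t => t / ε.toNNReal) θ₀ θ

/-- Stochastic gradient process with decreasing learning rate: index process `V_{β(t)}`. -/
def IsSGPD {S Ω : Type*} [mΩ : MeasurableSpace Ω] {K : ℕ} (𝓕 : Filtration ℝ≥0 mΩ)
    (V : ℝ≥0 → Ω → S) (f : EuclideanSpace ℝ (Fin K) → S → ℝ) (μ : ℝ → ℝ)
    (θ₀ : EuclideanSpace ℝ (Fin K)) (ξ : ℝ≥0 → Ω → EuclideanSpace ℝ (Fin K)) : Prop :=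
  IsGradientProcess 𝓕 V f (rescaledTime μ) θ₀ ξ

/-- The probability measure `Pst` on `ℝ^K × S` is stationary for the coupled Markov process
`(θ^ε_t, V_{t/ε})`. -/
def IsStationarySGPC {S Ω : Type*} [MeasurableSpace S] [mΩ : MeasurableSpace Ω] {K : ℕ}
    (𝓕 : Filtration ℝ≥0 mΩ) (P : Kernel S Ω) (V : ℝ≥0 → Ω → S)
    (f : EuclideanSpace ℝ (Fin K) → S → ℝ) (ε : ℝ)
    (Pst : Measure (EuclideanSpace ℝ (Fin K) × S)) : Prop :=
  IsProbabilityMeasure Pst ∧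
  ∃ θ : EuclideanSpace ℝ (Fin K) → ℝ≥0 → Ω → EuclideanSpace ℝ (Fin K),
    (∀ m, IsSGPC 𝓕 V f ε m (θ m)) ∧
    ∀ (t : ℝ≥0) (B : Set (EuclideanSpace ℝ (Fin K) × S)), MeasurableSet B →
      Pst B = ∫⁻ z, P z.2 {ω | (θ z.1 t ω, V (t / ε.toNNReal) ω) ∈ B} ∂Pst

/-- The Wasserstein distance on `ℝ^K` for the bounded metric `d(y, y') = 1 ∧ ‖y - y'‖`. -/
def wasserstein {K : ℕ} (ν ν' : Measure (EuclideanSpace ℝ (Fin K))) : ℝ≥0∞ :=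
  ⨅ (Γ : Measure (EuclideanSpace ℝ (Fin K) × EuclideanSpace ℝ (Fin K)))
    (_ : IsProbabilityMeasure Γ ∧ Γ.map Prod.fst = ν ∧ Γ.map Prod.snd = ν'),
    ∫⁻ p, ENNReal.ofReal (min 1 ‖p.1 - p.2‖) ∂Γ

/-- The rate `A(t) = e^{-κt/8} + [(μ(t) - μ(t/2))/μ(t)]^{1/2} + ρ(1/μ(t/2))`. -/
def rateA (κ : ℝ) (μ ρ : ℝ → ℝ) (t : ℝ) : ℝ :=
  Real.exp (-κ * t / 8) + Real.sqrt ((μ t - μ (t / 2)) / μ t) + ρ (1 / μ (t / 2))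

end SGP

end

/-!
The index process is uniquely ergodic on a compact space, so by a Krylov–Bogoliubov argument its
time averages converge uniformly in the starting point. At the minimizer `θ_*` of `Φ` the
mean `∫ ∇f(θ_*, y) π(dy)` vanishes, so the averages of `∇f(θ_*, V)` over long windows of fast time
are uniformly small.

Strong convexity first brings every solution into a fixed ball around `θ_*`. There
`d‖θ_t - θ_*‖² ≤ (-2κ ‖θ_t - θ_*‖² - 2 ⟨θ_t - θ_*, ∇f(θ_*, V)⟩) dt`. On a time step of length
`h ≈ √ε` the process `θ` hardly moves, while the index process runs through a window of length
`h / ε ≈ 1 / √ε`, so that the expected cross term is small by the averaging and the Markov property.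
Iterating this contraction over steps of length `h` gives a mean-square bound; for a decreasing rate
one runs the recursion on `[t/2, t]`, where the speed of the index process varies only by the
relative increment of `μ`. Chebyshev's and Jensen's inequalities turn the mean-square bounds into
Wasserstein bounds.
-/

noncomputable section

namespace SGP

section RightContinuous

/-- The leftmost point of the grid `ℤ / (n + 1)` lying strictly to the right of `t`. Evaluating a
right-continuous process there approximates it by jointly measurable processes. -/
def nextGridPoint (n : ℕ) (t : ℝ) : ℝ :=
  (⌊t * (n + 1)⌋ + 1) / (n + 1)

theorem tendsto_nextGridPoint (t : ℝ) :
    Tendsto (fun n => nextGridPoint n t) atTop (𝓝[≥] t) := by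
  have hle : ∀ n, t ≤ nextGridPoint n t := fun n => by
    rw [nextGridPoint, le_div_iff₀ (by positivity)]
    exact (Int.lt_floor_add_one _).le
  have hge : ∀ n, nextGridPoint n t ≤ t + 1 / ((n : ℝ) + 1) := fun n => by
    rw [nextGridPoint, add_div]
    gcongr
    rw [div_le_iff₀ (by positivity)]
    exact Int.floor_le _
  have hlim : Tendsto (fun n : ℕ => t + 1 / ((n : ℝ) + 1)) atTop (𝓝 t) := by
    simpa using (tendsto_one_div_add_atTop_nhds_zero_nat (𝕜 := ℝ)).const_add t
  exact tendsto_nhdsWithin_iff.2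
    ⟨tendsto_of_tendsto_of_tendsto_of_le_of_le tendsto_const_nhds hlim hle hge,
      Eventually.of_forall hle⟩

variable {α E : Type*} [TopologicalSpace E] [TopologicalSpace.PseudoMetrizableSpace E]
    [MeasurableSpace E] [BorelSpace E]

theorem measurable_uncurry_of_rightCont [MeasurableSpace α] {X : ℝ → α → E}
    (hX : ∀ t, Measurable (X t))
    (hc : ∀ a t, ContinuousWithinAt (fun s => X s a) (Set.Ici t) t) :
    Measurable (Function.uncurry X) := by
  refine measurable_of_tendsto_metrizable (f := fun n p => X (nextGridPoint n p.1) p.2)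
    (fun n => ?_) ?_
  · have hgrid : Measurable fun p : ℤ × α => X (((p.1 : ℝ) + 1) / (n + 1)) p.2 :=
      measurable_from_prod_countable_right fun k => hX (((k : ℝ) + 1) / (n + 1))
    have hfloor : Measurable fun p : ℝ × α => (⌊p.1 * (n + 1 : ℝ)⌋, p.2) :=
      (Int.measurable_floor.comp (measurable_fst.mul_const _)).prodMk measurable_snd
    simpa only [Function.comp_def, nextGridPoint] using hgrid.comp hfloor
  · rw [tendsto_pi_nhds]
    rintro ⟨t, a⟩
    exact (hc a t).tendsto.comp (tendsto_nextGridPoint t)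

theorem measurable_uncurry_nnreal_of_rightCont [MeasurableSpace α] {X : ℝ≥0 → α → E}
    (hX : ∀ t, Measurable (X t))
    (hc : ∀ a t, ContinuousWithinAt (fun s => X s a) (Set.Ici t) t) :
    Measurable (Function.uncurry X) := by
  have hreal : Measurable (Function.uncurry fun (r : ℝ) (a : α) => X r.toNNReal a) :=
    measurable_uncurry_of_rightCont (fun r => hX r.toNNReal) fun a r =>
      (hc a r.toNNReal).comp continuous_real_toNNReal.continuousWithinAt
        fun _ hr => Real.toNNReal_mono hr
  simpa only [Function.comp_def, Function.uncurry_def, Real.toNNReal_coe] using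
    hreal.comp ((measurable_coe_nnreal_real.comp measurable_fst).prodMk measurable_snd)

theorem measurable_of_rightCont {φ : ℝ → E}
    (hφ : ∀ t, ContinuousWithinAt φ (Set.Ici t) t) : Measurable φ :=
  (measurable_uncurry_of_rightCont (X := fun t (_ : Unit) => φ t) (fun _ => measurable_const)
    fun _ => hφ).comp (measurable_id.prodMk (measurable_const (a := ())))

end RightContinuous

section Integration

theorem exists_norm_le_of_continuous {S E : Type*} [TopologicalSpace S] [CompactSpace S]
    [SeminormedAddCommGroup E] {h : S → E} (hh : Continuous h) :
    ∃ B, 0 ≤ B ∧ ∀ y, ‖h y‖ ≤ B := by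
  obtain ⟨B, hB⟩ := (isCompact_range hh.norm).bddAbove
  exact ⟨max B 0, le_max_right _ _, fun y => (hB ⟨y, rfl⟩).trans (le_max_left _ _)⟩

theorem integrable_continuous_comp {S α E : Type*} [TopologicalSpace S] [CompactSpace S]
    [MeasurableSpace S] [OpensMeasurableSpace S] [MeasurableSpace α] [NormedAddCommGroup E]
    [SecondCountableTopology E] {h : S → E} (hh : Continuous h) {X : α → S} (hX : Measurable X)
    (m : Measure α) [IsFiniteMeasure m] : Integrable (fun a => h (X a)) m := by
  borelize E
  obtain ⟨B, -, hB⟩ := exists_norm_le_of_continuous hh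
  exact Integrable.of_bound (hh.measurable.comp hX).aestronglyMeasurable B
    (Eventually.of_forall fun a => hB (X a))

theorem integral_bind_kernel {α β E : Type*} [MeasurableSpace α] [MeasurableSpace β]
    [NormedAddCommGroup E] [NormedSpace ℝ E] {m : Measure α} [SFinite m] {η : Kernel α β}
    [IsSFiniteKernel η] {h : β → E} (hh : Integrable h (m.bind η)) :
    ∫ y, h y ∂(m.bind η) = ∫ x, ∫ y, h y ∂(η x) ∂m := by
  rw [Measure.comp_eq_comp_const_apply] at hh ⊢
  rw [Kernel.integral_comp hh, Kernel.const_apply]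

theorem tendsto_integral_of_tendsto_probabilityMeasure {ι S E : Type*} [TopologicalSpace S]
    [CompactSpace S] [MeasurableSpace S] [OpensMeasurableSpace S] [NormedAddCommGroup E]
    [NormedSpace ℝ E] [FiniteDimensional ℝ E] {l : Filter ι} {m : ι → ProbabilityMeasure S}
    {ν : ProbabilityMeasure S} (hm : Tendsto m l (𝓝 ν)) {h : S → E} (hh : Continuous h) :
    Tendsto (fun i => ∫ y, h y ∂(m i : Measure S)) l (𝓝 (∫ y, h y ∂(ν : Measure S))) := by
  let b := (Module.finBasis ℝ E).equivFunL
  have hcoord : ∀ (m : ProbabilityMeasure S) i,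
      b (∫ y, h y ∂(m : Measure S)) i = ∫ y, b (h y) i ∂(m : Measure S) := fun m i => by
    have hint : Integrable h (m : Measure S) := integrable_continuous_comp hh measurable_id _
    exact (((ContinuousLinearMap.proj (R := ℝ) i).comp
      (b : E →L[ℝ] Fin _ → ℝ)).integral_comp_comm hint).symm
  rw [b.toHomeomorph.isInducing.tendsto_nhds_iff, tendsto_pi_nhds]
  intro i
  have hbi : Continuous fun y => b (h y) i := by fun_prop
  simp only [Function.comp_def, ContinuousLinearEquiv.coe_toHomeomorph, hcoord]
  exact ProbabilityMeasure.tendsto_iff_forall_integral_tendsto.1 hm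
      (BoundedContinuousFunction.mkOfCompact ⟨_, hbi⟩)

end Integration

/-- The transition operator `E_x[h(V_t)]` of the process `V`, applied to a vector-valued
observable `h`. -/
def transition {S Ω E : Type*} [MeasurableSpace S] [MeasurableSpace Ω] [NormedAddCommGroup E]
    [NormedSpace ℝ E] (P : Kernel S Ω) (V : ℝ≥0 → Ω → S) (h : S → E) (t : ℝ≥0) (x : S) : E :=
  ∫ ω, h (V t ω) ∂(P x)

section Transition

variable {S Ω E : Type*} [NormedAddCommGroup E] [NormedSpace ℝ E]

section Boundedness

theorem isProbabilityMeasure_lawFrom [MeasurableSpace S] [MeasurableSpace Ω] (P : Kernel S Ω)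
    [IsMarkovKernel P] (ν : Measure S) [IsProbabilityMeasure ν] :
    IsProbabilityMeasure (lawFrom P ν) := by
  unfold lawFrom
  infer_instance

variable [MeasurableSpace S] [MeasurableSpace Ω] {P : Kernel S Ω} [IsMarkovKernel P]
    {V : ℝ≥0 → Ω → S} {h : S → E}

theorem norm_transition_le {B : ℝ} (hB : ∀ y, ‖h y‖ ≤ B) (t : ℝ≥0) (x : S) :
    ‖transition P V h t x‖ ≤ B := by
  simpa [transition] using
    norm_integral_le_of_norm_le_const (μ := P x) (Eventually.of_forall fun ω => hB (V t ω))

end Boundedness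

variable [TopologicalSpace S] [MeasurableSpace S] [mΩ : MeasurableSpace Ω]
    {𝓕 : Filtration ℝ≥0 mΩ} {P : Kernel S Ω} {V : ℝ≥0 → Ω → S}

theorem IsFellerProcess.measurable (hV : IsFellerProcess 𝓕 P V) (t : ℝ≥0) : Measurable (V t) :=
  (hV.adapted t).mono (𝓕.le t) le_rfl

theorem IsFellerProcess.measurable_uncurry [TopologicalSpace.PseudoMetrizableSpace S]
    [BorelSpace S] (hV : IsFellerProcess 𝓕 P V) : Measurable (Function.uncurry V) :=
  measurable_uncurry_nnreal_of_rightCont hV.measurable fun ω t => (hV.cadlag ω t).1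

theorem IsFellerProcess.map_restrict (hV : IsFellerProcess 𝓕 P V) (x : S) (s t : ℝ≥0)
    {F : Set Ω} (hF : MeasurableSet[𝓕 s] F) :
    ((P x).restrict F).map (V (s + t)) = (((P x).restrict F).map (V s)).bind (P.map (V t)) := by
  have := hV.isProb
  ext A hA
  have hVt : MeasurableSet (V t ⁻¹' A) := hV.measurable t hA
  have hVst : MeasurableSet (V (s + t) ⁻¹' A) := hV.measurable (s + t) hA
  have hmeas : Measurable fun ω => P (V s ω) (V t ⁻¹' A) :=
    (Kernel.measurable_coe P hVt).comp (hV.measurable s)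
  have hmarkov : ((P x).restrict F).real (V (s + t) ⁻¹' A) =
      ∫ ω in F, (P (V s ω)).real (V t ⁻¹' A) ∂(P x) := by
    rw [← integral_indicator_one hVst, ← setIntegral_congr_ae (𝓕.le s F hF)
      ((hV.markov x s t A hA).mono fun _ hω _ => hω), setIntegral_condExp (𝓕.le s)
      ((integrable_const _).indicator hVst) hF]
    rfl
  rw [Measure.map_apply (hV.measurable _) hA, Measure.bind_apply hA (Kernel.aemeasurable _),
    lintegral_map (Kernel.measurable_coe _ hA) (hV.measurable s)]
  simp only [Kernel.map_apply' P (hV.measurable t) _ hA]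
  rw [← ofReal_measureReal, hmarkov]
  simp only [measureReal_def]
  rw [integral_toReal hmeas.aemeasurable (Eventually.of_forall fun _ => measure_lt_top _ _),
    ENNReal.ofReal_toReal]
  exact ((setLIntegral_mono measurable_const fun _ _ => prob_le_one).trans_lt
    (by simp)).ne

variable [SecondCountableTopology E] {h : S → E}

theorem IsFellerProcess.measurable_transition [OpensMeasurableSpace S] [MeasurableSpace E]
    [BorelSpace E] [CompleteSpace E] (hV : IsFellerProcess 𝓕 P V) (hh : Continuous h) (t : ℝ≥0) :
    Measurable (transition P V h t) := by
  have := hV.isProb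
  exact (((hh.measurable.comp (hV.measurable t)).comp
    measurable_snd).stronglyMeasurable.integral_kernel_prod_right' (κ := P)).measurable

variable [CompactSpace S]

theorem IsFellerProcess.rightCont_transition [OpensMeasurableSpace S]
    (hV : IsFellerProcess 𝓕 P V) (hh : Continuous h) (x : S) (t : ℝ≥0) :
    ContinuousWithinAt (fun s => transition P V h s x) (Set.Ici t) t := by
  have := hV.isProb
  obtain ⟨B, -, hB⟩ := exists_norm_le_of_continuous hh
  refine tendsto_integral_filter_of_dominated_convergence (fun _ => B) ?_ ?_ (integrable_const B) ?_
  · exact Eventually.of_forall fun s =>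
      (integrable_continuous_comp hh (hV.measurable s) _).aestronglyMeasurable
  · exact Eventually.of_forall fun s => Eventually.of_forall fun ω => hB _
  · exact Eventually.of_forall fun ω => (hh.tendsto _).comp (hV.cadlag ω t).1

theorem IsFellerProcess.measurable_uncurry_transition [OpensMeasurableSpace S] [MeasurableSpace E]
    [BorelSpace E] [CompleteSpace E] (hV : IsFellerProcess 𝓕 P V) (hh : Continuous h) :
    Measurable (Function.uncurry (transition P V h)) :=
  measurable_uncurry_nnreal_of_rightCont (hV.measurable_transition hh) (hV.rightCont_transition hh)

theorem IsFellerProcess.intervalIntegrable_transition [OpensMeasurableSpace S] [CompleteSpace E]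
    (hV : IsFellerProcess 𝓕 P V) (hh : Continuous h) (x : S) (a b : ℝ) :
    IntervalIntegrable (fun u : ℝ => transition P V h u.toNNReal x) volume a b := by
  have := hV.isProb
  borelize E
  obtain ⟨B, -, hB⟩ := exists_norm_le_of_continuous hh
  have hm : Measurable fun u : ℝ => transition P V h u.toNNReal x :=
    (hV.measurable_uncurry_transition hh).comp (measurable_real_toNNReal.prodMk measurable_const)
  exact (intervalIntegrable_const (c := B)).mono_fun' hm.aestronglyMeasurable
    (Eventually.of_forall fun u => norm_transition_le hB _ _)

variable [OpensMeasurableSpace S] [CompleteSpace E]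

theorem IsFellerProcess.setIntegral_comp_add (hV : IsFellerProcess 𝓕 P V) (hh : Continuous h)
    (x : S) (s t : ℝ≥0) {F : Set Ω} (hF : MeasurableSet[𝓕 s] F) :
    ∫ ω in F, h (V (s + t) ω) ∂(P x) = ∫ ω in F, transition P V h t (V s ω) ∂(P x) := by
  have := hV.isProb
  borelize E
  have : IsMarkovKernel (P.map (V t)) := Kernel.IsMarkovKernel.map P (hV.measurable t)
  have hPt : ∀ z, ∫ y, h y ∂(P.map (V t) z) = transition P V h t z := fun z => by
    rw [Kernel.map_apply _ (hV.measurable t),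
      integral_map (hV.measurable t).aemeasurable hh.measurable.aestronglyMeasurable]
    rfl
  rw [← integral_map (hV.measurable _).aemeasurable hh.measurable.aestronglyMeasurable,
    hV.map_restrict x s t hF,
    integral_bind_kernel (h := h) (integrable_continuous_comp hh measurable_id _)]
  simp only [hPt]
  exact integral_map (hV.measurable s).aemeasurable
    (hV.measurable_transition hh t).aestronglyMeasurable

theorem IsFellerProcess.condExp_comp_add (hV : IsFellerProcess 𝓕 P V) (hh : Continuous h)
    (x : S) (s t : ℝ≥0) :
    (P x)[fun ω => h (V (s + t) ω) | 𝓕 s] =ᵐ[P x] fun ω => transition P V h t (V s ω) := by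
  have := hV.isProb
  borelize E
  obtain ⟨B, -, hB⟩ := exists_norm_le_of_continuous hh
  have hint : Integrable (fun ω => transition P V h t (V s ω)) (P x) := Integrable.of_bound
    ((hV.measurable_transition hh t).comp (hV.measurable s)).aestronglyMeasurable B
    (Eventually.of_forall fun ω => norm_transition_le hB t (V s ω))
  exact (ae_eq_condExp_of_forall_setIntegral_eq (𝓕.le s)
    (integrable_continuous_comp hh (hV.measurable _) _) (fun _ _ _ => hint.integrableOn)
    (fun F hF _ => (hV.setIntegral_comp_add hh x s t hF).symm)
    ((hV.measurable_transition hh t).comp (hV.adapted s)).stronglyMeasurable.aestronglyMeasurable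
    ).symm

theorem IsFellerProcess.transition_transition (hV : IsFellerProcess 𝓕 P V) (hh : Continuous h)
    (s t : ℝ≥0) (x : S) :
    transition P V (transition P V h t) s x = transition P V h (s + t) x := by
  simpa [transition] using (hV.setIntegral_comp_add hh x s t MeasurableSet.univ).symm

end Transition

theorem IsFellerProcess.integral_inner_comp_add {S Ω E : Type*} [NormedAddCommGroup E]
    [InnerProductSpace ℝ E] [CompleteSpace E] [SecondCountableTopology E] [MeasurableSpace E]
    [BorelSpace E] [TopologicalSpace S] [CompactSpace S] [MeasurableSpace S]
    [OpensMeasurableSpace S] [mΩ : MeasurableSpace Ω] {𝓕 : Filtration ℝ≥0 mΩ} {P : Kernel S Ω}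
    {V : ℝ≥0 → Ω → S} (hV : IsFellerProcess 𝓕 P V) {h : S → E} (hh : Continuous h) (x : S)
    (s t : ℝ≥0) {Z : Ω → E} (hZ : Measurable[𝓕 s] Z) (hZint : Integrable Z (P x)) :
    ∫ ω, inner ℝ (Z ω) (h (V (s + t) ω)) ∂(P x) =
      ∫ ω, inner ℝ (Z ω) (transition P V h t (V s ω)) ∂(P x) := by
  have := hV.isProb
  obtain ⟨B, -, hB⟩ := exists_norm_le_of_continuous hh
  have hint : Integrable (fun ω => h (V (s + t) ω)) (P x) :=
    integrable_continuous_comp hh (hV.measurable _) _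
  have hinner : Integrable (fun ω => innerSL ℝ (Z ω) (h (V (s + t) ω))) (P x) :=
    (hZint.norm.mul_const B).mono'
      (hZint.aestronglyMeasurable.inner hint.aestronglyMeasurable)
      (Eventually.of_forall fun ω => (norm_inner_le_norm _ _).trans (by gcongr; exact hB _))
  calc ∫ ω, inner ℝ (Z ω) (h (V (s + t) ω)) ∂(P x)
      = ∫ ω, ((P x)[fun ω => innerSL ℝ (Z ω) (h (V (s + t) ω)) | 𝓕 s]) ω ∂(P x) :=
        (integral_condExp (𝓕.le s)).symm
    _ = ∫ ω, inner ℝ (Z ω) (((P x)[fun ω => h (V (s + t) ω) | 𝓕 s]) ω) ∂(P x) :=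
        integral_congr_ae
          (condExp_bilin_of_stronglyMeasurable_left (innerSL ℝ) hZ.stronglyMeasurable hinner hint)
    _ = ∫ ω, inner ℝ (Z ω) (transition P V h t (V s ω)) ∂(P x) :=
        integral_congr_ae ((hV.condExp_comp_add hh x s t).mono fun ω hω => by simp only [hω])

section Ergodic

variable {S Ω E : Type*} [NormedAddCommGroup E] [NormedSpace ℝ E] [MeasurableSpace S]

/-- The time average `L⁻¹ ∫₀ᴸ E_x[h(V_u)] du` of the observable `h` along the process. -/
def timeAverage [MeasurableSpace Ω] (P : Kernel S Ω) (V : ℝ≥0 → Ω → S) (h : S → E) (L : ℝ)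
    (x : S) : E :=
  L⁻¹ • ∫ u in (0 : ℝ)..L, transition P V h u.toNNReal x

variable [mΩ : MeasurableSpace Ω] {𝓕 : Filtration ℝ≥0 mΩ} {P : Kernel S Ω}
    {V : ℝ≥0 → Ω → S} {h : S → E}

theorem norm_integral_transition_le [IsMarkovKernel P] {B : ℝ} (hB : ∀ y, ‖h y‖ ≤ B) (a b : ℝ)
    (x : S) : ‖∫ u in a..b, transition P V h u.toNNReal x‖ ≤ B * |b - a| :=
  intervalIntegral.norm_integral_le_of_norm_le_const fun _ _ => norm_transition_le hB _ _

theorem norm_timeAverage_le [IsMarkovKernel P] {B : ℝ} (hB : ∀ y, ‖h y‖ ≤ B) {L : ℝ}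
    (hL : 0 < L) (x : S) : ‖timeAverage P V h L x‖ ≤ B := by
  rw [timeAverage, norm_smul, norm_inv, Real.norm_of_nonneg hL.le, inv_mul_le_iff₀ hL, mul_comm L]
  simpa [abs_of_pos hL] using norm_integral_transition_le hB 0 L x

variable [TopologicalSpace S]

theorem IsFellerProcess.continuous_transition [CompactSpace S] (hV : IsFellerProcess 𝓕 P V)
    {h : S → ℝ} (hh : Continuous h) (t : ℝ≥0) : Continuous (transition P V h t) :=
  hV.feller t ⟨h, hh⟩

section Occupation

variable [TopologicalSpace.PseudoMetrizableSpace S] [BorelSpace S]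

/-- The expected occupation measure of the process on `[0, L]`, started in `x`, realized as the
law of `V_{L U}` for an independent uniform time `U` in `[0, 1]`. -/
def IsFellerProcess.occupation (hV : IsFellerProcess 𝓕 P V) (L : ℝ) (x : S) :
    ProbabilityMeasure S :=
  ⟨((volume.restrict (Set.Ioc (0 : ℝ) 1)).prod (P x)).map fun p => V (L * p.1).toNNReal p.2, by
    have := hV.isProb
    have : IsProbabilityMeasure (volume.restrict (Set.Ioc (0 : ℝ) 1)) := ⟨by simp⟩
    have hm : Measurable fun p : ℝ × Ω => V (L * p.1).toNNReal p.2 :=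
      hV.measurable_uncurry.comp ((measurable_fst.const_mul L).real_toNNReal.prodMk measurable_snd)
    exact Measure.isProbabilityMeasure_map hm.aemeasurable⟩

end Occupation

variable [CompactSpace S]

/-- By the Markov property the first average runs over `[t, L + t]`, a window which differs from
`[0, L]` by two intervals of length `t`. -/
theorem IsFellerProcess.norm_timeAverage_transition_sub_le [OpensMeasurableSpace S]
    [SecondCountableTopology E] [CompleteSpace E] (hV : IsFellerProcess 𝓕 P V)
    (hh : Continuous h) {B : ℝ} (hB : ∀ y, ‖h y‖ ≤ B) {L : ℝ} (hL : 0 < L) (t : ℝ≥0) (x : S) :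
    ‖timeAverage P V (transition P V h t) L x - timeAverage P V h L x‖ ≤ 2 * B * t / L := by
  have := hV.isProb
  have hint := hV.intervalIntegrable_transition hh x
  have hshift : ∫ u in (0 : ℝ)..L, transition P V (transition P V h t) u.toNNReal x =
      ∫ u in (t : ℝ)..(L + t), transition P V h u.toNNReal x := by
    have hcomp := intervalIntegral.integral_comp_add_right (a := 0) (b := L)
      (fun u => transition P V h u.toNNReal x) (t : ℝ)
    rw [zero_add] at hcomp
    rw [← hcomp]
    refine intervalIntegral.integral_congr fun u hu => ?_
    rw [Set.uIcc_of_le hL.le] at hu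
    rw [hV.transition_transition hh, Real.toNNReal_add hu.1 t.coe_nonneg, Real.toNNReal_coe]
  have hsplit : (∫ u in (t : ℝ)..(L + t), transition P V h u.toNNReal x) -
      ∫ u in (0 : ℝ)..L, transition P V h u.toNNReal x =
      (∫ u in L..(L + t), transition P V h u.toNNReal x) -
        ∫ u in (0 : ℝ)..t, transition P V h u.toNNReal x := by
    rw [← intervalIntegral.integral_add_adjacent_intervals (hint 0 t) (hint t L),
      ← intervalIntegral.integral_add_adjacent_intervals (hint t L) (hint L (L + t))]
    abel
  rw [timeAverage, timeAverage, ← smul_sub, hshift, hsplit, norm_smul, norm_inv,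
    Real.norm_of_nonneg hL.le, inv_mul_le_iff₀ hL, mul_div_cancel₀ _ hL.ne']
  calc _ ≤ B * |L + t - L| + B * |(t : ℝ) - 0| := (norm_sub_le _ _).trans
        (add_le_add (norm_integral_transition_le hB _ _ x) (norm_integral_transition_le hB _ _ x))
    _ = 2 * B * t := by
        rw [add_sub_cancel_left, sub_zero, NNReal.abs_eq]
        ring

variable [TopologicalSpace.PseudoMetrizableSpace S] [BorelSpace S]

theorem IsFellerProcess.integral_occupation [SecondCountableTopology E]
    (hV : IsFellerProcess 𝓕 P V) (hh : Continuous h) {L : ℝ} (hL : L ≠ 0) (x : S) :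
    ∫ y, h y ∂(hV.occupation L x : Measure S) = timeAverage P V h L x := by
  have := hV.isProb
  borelize E
  have hm : Measurable fun p : ℝ × Ω => V (L * p.1).toNNReal p.2 :=
    hV.measurable_uncurry.comp ((measurable_fst.const_mul L).real_toNNReal.prodMk measurable_snd)
  have hscale := intervalIntegral.integral_comp_mul_left (a := 0) (b := 1)
    (fun u => transition P V h u.toNNReal x) hL
  rw [mul_zero, mul_one] at hscale
  rw [timeAverage, ← hscale, intervalIntegral.integral_of_le zero_le_one]
  exact (integral_map hm.aemeasurable hh.measurable.aestronglyMeasurable).trans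
    (integral_prod _ (integrable_continuous_comp hh hm _))

theorem IsFellerProcess.isInvariantFor_of_tendsto_occupation (hV : IsFellerProcess 𝓕 P V)
    {ι : Type*} {l : Filter ι} [l.NeBot] {L : ι → ℝ} (hL : Tendsto L l atTop) {x : ι → S}
    {ν : ProbabilityMeasure S} (hν : Tendsto (fun i => hV.occupation (L i) (x i)) l (𝓝 ν)) :
    IsInvariantFor P V (ν : Measure S) := by
  have := hV.isProb
  refine ⟨inferInstance, fun t => ?_⟩
  have := isProbabilityMeasure_lawFrom P (ν : Measure S)
  have : IsProbabilityMeasure ((lawFrom P (ν : Measure S)).map (V t)) :=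
    Measure.isProbabilityMeasure_map (hV.measurable t).aemeasurable
  refine ext_of_forall_integral_eq_of_IsFiniteMeasure fun g => ?_
  have hg : Continuous g := g.continuous
  obtain ⟨B, -, hB⟩ := exists_norm_le_of_continuous hg
  have hlim : Tendsto (fun i => timeAverage P V (transition P V g t) (L i) (x i) -
      timeAverage P V g (L i) (x i)) l
      (𝓝 (∫ y, transition P V g t y ∂(ν : Measure S) - ∫ y, g y ∂(ν : Measure S))) := by
    refine ((tendsto_integral_of_tendsto_probabilityMeasure hν
      (hV.continuous_transition hg t)).sub
      (tendsto_integral_of_tendsto_probabilityMeasure hν hg)).congr' ?_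
    filter_upwards [hL.eventually_ne_atTop 0] with i hi
    rw [hV.integral_occupation (hV.continuous_transition hg t) hi, hV.integral_occupation hg hi]
  have hzero : Tendsto (fun i => timeAverage P V (transition P V g t) (L i) (x i) -
      timeAverage P V g (L i) (x i)) l (𝓝 0) := by
    refine squeeze_zero_norm' ?_ (hL.const_div_atTop (2 * B * t))
    filter_upwards [hL.eventually_gt_atTop 0] with i hi
    exact hV.norm_timeAverage_transition_sub_le hg hB hi t (x i)
  have hbind : ∫ ω, g (V t ω) ∂(lawFrom P (ν : Measure S)) =
      ∫ y, transition P V g t y ∂(ν : Measure S) :=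
    integral_bind_kernel (integrable_continuous_comp hg (hV.measurable t) _)
  rw [integral_map (hV.measurable t).aemeasurable hg.aestronglyMeasurable, hbind]
  exact sub_eq_zero.1 (tendsto_nhds_unique hlim hzero)

/-- Convergence along `atTop ×ˢ ⊤` is convergence as `L → ∞`, uniformly in the starting point. -/
theorem IsFellerProcess.tendsto_occupation [T2Space S] (hV : IsFellerProcess 𝓕 P V)
    {π : ProbabilityMeasure S} (huniq : ∀ ν : Measure S, IsInvariantFor P V ν → ν = π) :
    Tendsto (fun p : ℝ × S => hV.occupation p.1 p.2) (atTop ×ˢ ⊤) (𝓝 π) := by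
  refine tendsto_nhds_of_unique_mapClusterPt fun ν hν => ?_
  obtain ⟨U, hU, hlim⟩ := mapClusterPt_iff_ultrafilter.1 hν
  exact Subtype.ext (huniq _ (hV.isInvariantFor_of_tendsto_occupation
    (tendsto_fst.mono_left hU) (x := Prod.snd) hlim))

theorem IsFellerProcess.tendsto_timeAverage [T2Space S] [FiniteDimensional ℝ E]
    (hV : IsFellerProcess 𝓕 P V) {π : Measure S} [IsProbabilityMeasure π]
    (huniq : ∀ ν : Measure S, IsInvariantFor P V ν → ν = π) (hh : Continuous h) :
    Tendsto (fun p : ℝ × S => timeAverage P V h p.1 p.2) (atTop ×ˢ ⊤) (𝓝 (∫ y, h y ∂π)) := by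
  refine (tendsto_integral_of_tendsto_probabilityMeasure
    (hV.tendsto_occupation (π := ⟨π, inferInstance⟩) huniq) hh).congr' ?_
  filter_upwards [tendsto_fst.eventually_ne_atTop 0] with p hp
  exact hV.integral_occupation hh hp p.2

end Ergodic

section AveragingModulus

variable {S Ω E : Type*} [NormedAddCommGroup E] [NormedSpace ℝ E] [MeasurableSpace S]

/-- The largest norm of a time average of `h` over a window `[0, L']` with `L' ≥ L`. For a
`π`-centred observable of a uniquely ergodic Feller process it tends to `0` as `L → ∞`. -/
def averagingModulus [MeasurableSpace Ω] (P : Kernel S Ω) (V : ℝ≥0 → Ω → S) (h : S → E)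
    (L : ℝ) : ℝ :=
  ⨆ p : Set.Ici L × S, ‖timeAverage P V h p.1 p.2‖

variable [mΩ : MeasurableSpace Ω] {P : Kernel S Ω} {V : ℝ≥0 → Ω → S} {h : S → E}

theorem averagingModulus_nonneg (L : ℝ) : 0 ≤ averagingModulus P V h L :=
  Real.iSup_nonneg fun _ => norm_nonneg _

theorem norm_integral_transition_le_averagingModulus [IsMarkovKernel P] {B : ℝ}
    (hB : ∀ y, ‖h y‖ ≤ B) {L L' : ℝ} (hL' : 0 < L') (hL : L' ≤ L) (x : S) :
    ‖∫ u in (0 : ℝ)..L, transition P V h u.toNNReal x‖ ≤ L * averagingModulus P V h L' := by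
  have hbdd : BddAbove (Set.range fun p : Set.Ici L' × S => ‖timeAverage P V h p.1 p.2‖) :=
    ⟨B, by
      rintro _ ⟨⟨M, y⟩, rfl⟩
      exact norm_timeAverage_le hB (hL'.trans_le M.2) y⟩
  have hL0 : 0 < L := hL'.trans_le hL
  have hle : ‖timeAverage P V h L x‖ ≤ averagingModulus P V h L' :=
    le_ciSup hbdd (⟨L, hL⟩, x)
  rwa [timeAverage, norm_smul, norm_inv, Real.norm_of_nonneg hL0.le, inv_mul_le_iff₀ hL0] at hle

theorem IsFellerProcess.tendsto_averagingModulus [TopologicalSpace S] [CompactSpace S]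
    [T2Space S] [TopologicalSpace.PseudoMetrizableSpace S] [BorelSpace S] [FiniteDimensional ℝ E]
    {𝓕 : Filtration ℝ≥0 mΩ} (hV : IsFellerProcess 𝓕 P V)
    {π : Measure S} [IsProbabilityMeasure π]
    (huniq : ∀ ν : Measure S, IsInvariantFor P V ν → ν = π) (hh : Continuous h)
    (hmean : ∫ y, h y ∂π = 0) : Tendsto (averagingModulus P V h) atTop (𝓝 0) := by
  have hlim := (hV.tendsto_timeAverage huniq hh).norm
  rw [hmean, norm_zero] at hlim
  refine tendsto_order.2
    ⟨fun c hc => .of_forall fun L => hc.trans_le (averagingModulus_nonneg L), fun η hη => ?_⟩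
  obtain ⟨L₀, hL₀⟩ := mem_atTop_sets.1
    (mem_prod_top.1 (hlim.eventually (gt_mem_nhds (half_pos hη))))
  filter_upwards [eventually_ge_atTop L₀] with L hL
  have hle : ∀ p : Set.Ici L × S, ‖timeAverage P V h p.1 p.2‖ ≤ η / 2 := fun p =>
    (Set.mem_ofPred.1 (hL₀ p.1 (hL.trans p.1.2) p.2)).le
  exact (Real.iSup_le hle (half_pos hη).le).trans_lt (half_lt_self hη)

end AveragingModulus

section StrongConvexity

variable {F : Type*} [NormedAddCommGroup F] [InnerProductSpace ℝ F]

theorem add_inner_gradient_add_le [CompleteSpace F] {g : F → ℝ} (hg : Differentiable ℝ g) {κ : ℝ}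
    (hmono : ∀ x z, κ * ‖x - z‖ ^ 2 ≤ inner ℝ (x - z) (gradient g x - gradient g z)) (x z : F) :
    g z + inner ℝ (gradient g z) (x - z) + κ / 2 * ‖x - z‖ ^ 2 ≤ g x := by
  let ψ : ℝ → ℝ := fun s => g (z + s • (x - z)) - s * inner ℝ (gradient g z) (x - z) -
    κ / 2 * s ^ 2 * ‖x - z‖ ^ 2
  let ψ' : ℝ → ℝ := fun s => inner ℝ (gradient g (z + s • (x - z))) (x - z) -
    inner ℝ (gradient g z) (x - z) - κ * s * ‖x - z‖ ^ 2
  have hψ : ∀ s, HasDerivAt ψ (ψ' s) s := by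
    intro s
    have hline : HasDerivAt (fun s : ℝ => z + s • (x - z)) (x - z) s := by
      simpa using ((hasDerivAt_id s).smul_const (x - z)).const_add z
    have hcomp := (hg (z + s • (x - z))).hasGradientAt.hasFDerivAt.comp_hasDerivAt s hline
    have hlin := (hasDerivAt_id s).mul_const (inner ℝ (gradient g z) (x - z))
    have hquad := (((hasDerivAt_id s).pow 2).const_mul (κ / 2)).mul_const (‖x - z‖ ^ 2)
    refine ((hcomp.sub hlin).sub hquad).congr_deriv ?_
    simp only [ψ', InnerProductSpace.toDual_apply_apply, id_eq, one_mul, mul_one]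
    ring
  have hnonneg : ∀ s ∈ Set.Ioo (0 : ℝ) 1, 0 ≤ ψ' s := by
    intro s hs
    have h := hmono (z + s • (x - z)) z
    rw [add_sub_cancel_left, norm_smul, real_inner_smul_left, Real.norm_of_nonneg hs.1.le,
      real_inner_comm, inner_sub_left, mul_pow] at h
    rw [show κ * (s ^ 2 * ‖x - z‖ ^ 2) = s * (κ * s * ‖x - z‖ ^ 2) by ring] at h
    exact sub_nonneg.2 (le_of_mul_le_mul_left h hs.1)
  have hmonoψ : MonotoneOn ψ (Set.Icc 0 1) := by
    refine monotoneOn_of_deriv_nonneg (convex_Icc 0 1)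
      (fun s _ => (hψ s).continuousAt.continuousWithinAt)
      (fun s _ => (hψ s).differentiableAt.differentiableWithinAt) fun s hs => ?_
    rw [interior_Icc] at hs
    exact (hψ s).deriv ▸ hnonneg s hs
  have := hmonoψ (Set.left_mem_Icc.2 zero_le_one) (Set.right_mem_Icc.2 zero_le_one) zero_le_one
  simp only [ψ, zero_smul, one_smul, add_zero, add_sub_cancel, zero_mul, one_mul, one_pow,
    mul_one, ne_eq, OfNat.ofNat_ne_zero, not_false_eq_true, zero_pow, mul_zero, sub_zero] at this
  linarith

theorem exists_forall_le_of_quadratic_le [ProperSpace F] {Φ : F → ℝ} (hΦ : Continuous Φ) {κ : ℝ}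
    (hκ : 0 < κ) {z v : F} (hquad : ∀ x, Φ z + inner ℝ v (x - z) + κ / 2 * ‖x - z‖ ^ 2 ≤ Φ x) :
    ∃ θ, ∀ x, Φ θ ≤ Φ x := by
  have hlower : ∀ x, Φ z + ‖x - z‖ * (κ / 2 * ‖x - z‖ - ‖v‖) ≤ Φ x := fun x => by
    have := neg_le_of_abs_le (abs_real_inner_le_norm v (x - z))
    linarith [hquad x]
  have hpoly : Tendsto (fun r : ℝ => Φ z + r * (κ / 2 * r - ‖v‖)) atTop atTop :=
    tendsto_atTop_add_const_left _ _ (tendsto_id.atTop_mul_atTop₀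
      (tendsto_atTop_add_const_right _ _ (tendsto_id.const_mul_atTop (half_pos hκ))))
  have hnorm : Tendsto (fun x => ‖x - z‖) (cocompact F) atTop :=
    tendsto_norm_cocompact_atTop.comp
      (Homeomorph.subRight z).isClosedEmbedding.tendsto_cocompact
  exact hΦ.exists_forall_le (tendsto_atTop_mono hlower (hpoly.comp hnorm))

theorem eq_zero_of_subgradient_of_forall_le {Φ : F → ℝ} {g : F → F}
    (hsub : ∀ x z, Φ z + inner ℝ (g z) (x - z) ≤ Φ x) {θ : F} (hg : ContinuousAt g θ)
    (hmin : ∀ x, Φ θ ≤ Φ x) : g θ = 0 := by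
  have hdir : ∀ s > (0 : ℝ), inner ℝ (g (θ - s • g θ)) (g θ) ≤ 0 := by
    intro s hs
    have h := (hsub θ (θ - s • g θ)).trans (hmin (θ - s • g θ))
    rw [sub_sub_cancel, real_inner_smul_right] at h
    exact nonpos_of_mul_nonpos_right (nonpos_of_add_le_right h) hs
  have hlim : Tendsto (fun s : ℝ => inner ℝ (g (θ - s • g θ)) (g θ)) (𝓝[>] 0)
      (𝓝 (inner ℝ (g θ) (g θ))) := by
    have hline : Tendsto (fun s : ℝ => θ - s • g θ) (𝓝[>] 0) (𝓝 θ) :=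
      Continuous.tendsto' (by fun_prop) 0 θ (by simp) |>.mono_left nhdsWithin_le_nhds
    exact (hg.tendsto.comp hline).inner tendsto_const_nhds
  exact real_inner_self_nonpos.1 (le_of_tendsto hlim (eventually_mem_nhdsWithin.mono hdir))

end StrongConvexity

section Target

variable {S : Type*} [TopologicalSpace S] [CompactSpace S] [MeasurableSpace S]
    [OpensMeasurableSpace S] {K : ℕ} {f : EuclideanSpace ℝ (Fin K) → S → ℝ} {π : Measure S}
    [IsProbabilityMeasure π] {κ : ℝ}

theorem continuous_integral_of_continuous_uncurry {X G : Type*} [TopologicalSpace X]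
    [FirstCountableTopology X] [LocallyCompactSpace X] [NormedAddCommGroup G] [NormedSpace ℝ G]
    [SecondCountableTopology G] {h : X → S → G} (hh : Continuous fun p : X × S => h p.1 p.2) :
    Continuous fun x => ∫ y, h x y ∂π := by
  simpa using continuous_parametric_integral_of_continuous (μ := π) hh isCompact_univ

theorem UniformlyStronglyConvex.fullTarget_add_inner_add_le
    (hconv : UniformlyStronglyConvex f κ)
    (hf : Continuous fun p : EuclideanSpace ℝ (Fin K) × S => f p.1 p.2)
    (hdiff : ∀ y, Differentiable ℝ fun θ => f θ y)
    (hgrad : Continuous fun p : EuclideanSpace ℝ (Fin K) × S => gradθ f p.1 p.2)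
    (x z : EuclideanSpace ℝ (Fin K)) :
    fullTarget f π z + inner ℝ (∫ y, gradθ f z y ∂π) (x - z) + κ / 2 * ‖x - z‖ ^ 2 ≤
      fullTarget f π x := by
  have hfint : ∀ θ, Integrable (f θ) π := fun θ =>
    integrable_continuous_comp (hf.comp (Continuous.prodMk_right θ)) measurable_id π
  have hgint : Integrable (gradθ f z) π :=
    integrable_continuous_comp (hgrad.comp (Continuous.prodMk_right z)) measurable_id π
  have hinner : Integrable (fun y => inner ℝ (gradθ f z y) (x - z)) π := hgint.inner_const _
  have hswap : ∫ y, inner ℝ (gradθ f z y) (x - z) ∂π =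
      inner ℝ (∫ y, gradθ f z y ∂π) (x - z) := by
    simp only [real_inner_comm (x - z)]
    exact integral_inner hgint (x - z)
  calc fullTarget f π z + inner ℝ (∫ y, gradθ f z y ∂π) (x - z) + κ / 2 * ‖x - z‖ ^ 2
      = ∫ y, (f z y + inner ℝ (gradθ f z y) (x - z) + κ / 2 * ‖x - z‖ ^ 2) ∂π := by
        rw [integral_add (by exact (hfint z).add hinner) (integrable_const _),
          integral_add (hfint z) hinner, hswap, integral_const, probReal_univ, one_smul]
        rfl
    _ ≤ fullTarget f π x := integral_mono (((hfint z).add hinner).add (integrable_const _))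
        (hfint x) fun y => add_inner_gradient_add_le (hdiff y) (hconv y) x z

theorem UniformlyStronglyConvex.exists_minimizer (hκ : 0 < κ)
    (hconv : UniformlyStronglyConvex f κ)
    (hf : Continuous fun p : EuclideanSpace ℝ (Fin K) × S => f p.1 p.2)
    (hdiff : ∀ y, Differentiable ℝ fun θ => f θ y)
    (hgrad : Continuous fun p : EuclideanSpace ℝ (Fin K) × S => gradθ f p.1 p.2) :
    ∃ θstar, ∫ y, gradθ f θstar y ∂π = 0 ∧ ∀ θ,
      fullTarget f π θstar + κ / 2 * ‖θ - θstar‖ ^ 2 ≤ fullTarget f π θ := by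
  have hquad := hconv.fullTarget_add_inner_add_le (π := π) hf hdiff hgrad
  obtain ⟨θstar, hmin⟩ := exists_forall_le_of_quadratic_le
    (continuous_integral_of_continuous_uncurry (π := π) hf) hκ fun x => hquad x 0
  have hsub : ∀ x z, fullTarget f π z + inner ℝ (∫ y, gradθ f z y ∂π) (x - z) ≤
      fullTarget f π x := fun x z =>
    (le_add_of_nonneg_right (by positivity)).trans (hquad x z)
  have hzero : ∫ y, gradθ f θstar y ∂π = 0 := eq_zero_of_subgradient_of_forall_le hsub
    (continuous_integral_of_continuous_uncurry hgrad).continuousAt hmin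
  refine ⟨θstar, hzero, fun θ => ?_⟩
  simpa only [hzero, inner_zero_left, add_zero] using hquad θ θstar

end Target

section DrivenPath

/-- `x` solves `dx_t = -b(x_t, v_t) dt`, `x_0 = x₀`, on `[0, ∞)`, in integrated form, where the
driving path `v` is right-continuous. -/
structure IsDrivenPath {S E : Type*} [TopologicalSpace S] [NormedAddCommGroup E]
    [NormedSpace ℝ E] (b : E → S → E) (v : ℝ → S) (x₀ : E) (x : ℝ → E) : Prop where
  rightCont : ∀ t, ContinuousWithinAt v (Set.Ici t) t
  cont : Continuous x
  eqn : ∀ t, 0 ≤ t → x t = x₀ - ∫ s in (0 : ℝ)..t, b (x s) (v s)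

/-- The vector field `b(·, y)` is strongly monotone at the point `c` and of size at most `B` there,
uniformly in the parameter `y`. Paths driven by `-b` are then attracted to a ball around `c`. -/
structure IsDissipativeAt {S E : Type*} [TopologicalSpace S] [NormedAddCommGroup E]
    [InnerProductSpace ℝ E] (b : E → S → E) (c : E) (κ B : ℝ) : Prop where
  cont : Continuous fun p : E × S => b p.1 p.2
  pos : 0 < κ
  le_inner : ∀ x y, κ * ‖x - c‖ ^ 2 ≤ inner ℝ (x - c) (b x y - b c y)
  norm_le : ∀ y, ‖b c y‖ ≤ B

/-- Radius of a ball around `c` which paths driven by a dissipative vector field never leave after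
an initial time that depends only on the distance of the starting point to `c`. -/
def absorbingRadius (κ B : ℝ) : ℝ :=
  √(1 + B ^ 2 / κ ^ 2)

theorem absorbingRadius_nonneg (κ B : ℝ) : 0 ≤ absorbingRadius κ B :=
  Real.sqrt_nonneg _

theorem absorbingRadius_sq (κ B : ℝ) : absorbingRadius κ B ^ 2 = 1 + B ^ 2 / κ ^ 2 :=
  Real.sq_sqrt (by positivity)

variable {S E : Type*} [TopologicalSpace S] [NormedAddCommGroup E] [InnerProductSpace ℝ E]
    {b : E → S → E} {c : E} {κ B : ℝ}

theorem IsDissipativeAt.continuous (hb : IsDissipativeAt b c κ B) : Continuous (b c) :=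
  hb.cont.comp (Continuous.prodMk_right c)

theorem IsDissipativeAt.neg_two_inner_le (hb : IsDissipativeAt b c κ B) (x : E) (y : S) :
    -2 * inner ℝ (x - c) (b x y) ≤ -κ * ‖x - c‖ ^ 2 + B ^ 2 / κ := by
  have hmono := hb.le_inner x y
  rw [inner_sub_right] at hmono
  have hcs : -(‖x - c‖ * B) ≤ inner ℝ (x - c) (b c y) :=
    neg_le_of_abs_le ((abs_real_inner_le_norm _ _).trans (by gcongr; exact hb.norm_le y))
  have hyoung : 2 * (‖x - c‖ * B) ≤ κ * ‖x - c‖ ^ 2 + B ^ 2 / κ := by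
    have hκ := hb.pos
    have hsq : κ * ‖x - c‖ ^ 2 + B ^ 2 / κ - 2 * (‖x - c‖ * B) = (κ * ‖x - c‖ - B) ^ 2 / κ := by
      field_simp
      ring
    linarith [show 0 ≤ (κ * ‖x - c‖ - B) ^ 2 / κ by positivity]
  linarith

theorem IsDissipativeAt.neg_two_inner_le_frozen (hb : IsDissipativeAt b c κ B) {x z : E}
    {A δ : ℝ} (hx : ‖x - c‖ ≤ A) (hz : ‖z - c‖ ≤ A) (hxz : ‖x - z‖ ≤ δ) (y : S) :
    -2 * inner ℝ (x - c) (b x y) ≤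
      -2 * κ * ‖z - c‖ ^ 2 - 2 * inner ℝ (z - c) (b c y) + (4 * κ * A + 2 * B) * δ := by
  have hmono := hb.le_inner x y
  rw [inner_sub_right] at hmono
  have hinner : inner ℝ (z - c) (b c y) - inner ℝ (x - c) (b c y) ≤ δ * B := by
    rw [← inner_sub_left, sub_sub_sub_cancel_right]
    refine (real_inner_le_norm _ _).trans ?_
    rw [norm_sub_rev]
    exact mul_le_mul hxz (hb.norm_le y) (norm_nonneg _) ((norm_nonneg _).trans hxz)
  have hnorm : ‖z - c‖ ^ 2 - ‖x - c‖ ^ 2 ≤ 2 * A * δ := by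
    have hsub : ‖z - c‖ - ‖x - c‖ ≤ δ := by
      refine (norm_sub_norm_le _ _).trans ?_
      rwa [sub_sub_sub_cancel_right, norm_sub_rev]
    calc ‖z - c‖ ^ 2 - ‖x - c‖ ^ 2 = (‖z - c‖ + ‖x - c‖) * (‖z - c‖ - ‖x - c‖) := by ring
      _ ≤ (‖z - c‖ + ‖x - c‖) * δ := by gcongr
      _ ≤ 2 * A * δ := by
        have := (norm_nonneg _).trans hxz
        gcongr
        linarith
  have := mul_le_mul_of_nonneg_left hnorm hb.pos.le
  linarith

variable [SecondCountableTopology E] {v : ℝ → S} {x₀ : E} {x : ℝ → E}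

theorem IsDrivenPath.intervalIntegrable [CompactSpace S] (hx : IsDrivenPath b v x₀ x)
    (hb : Continuous fun p : E × S => b p.1 p.2) (s t : ℝ) :
    IntervalIntegrable (fun r => b (x r) (v r)) volume s t := by
  borelize E
  have hm : Measurable fun r => b (x r) (v r) := measurable_of_rightCont fun r =>
    hb.continuousAt.comp_continuousWithinAt (hx.cont.continuousWithinAt.prodMk (hx.rightCont r))
  obtain ⟨M, hM⟩ := (((isCompact_uIcc (a := s) (b := t)).image hx.cont).prod
    (isCompact_univ (X := S))).bddAbove_image hb.norm.continuousOn
  refine (intervalIntegrable_const (c := M)).mono_fun' hm.aestronglyMeasurable ?_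
  refine (ae_restrict_iff' measurableSet_uIoc).2 (Eventually.of_forall fun r hr => ?_)
  exact hM ⟨(x r, v r), ⟨⟨r, Set.uIoc_subset_uIcc hr, rfl⟩, trivial⟩, rfl⟩

theorem IsDrivenPath.intervalIntegrable_driver (hx : IsDrivenPath b v x₀ x)
    (hb : IsDissipativeAt b c κ B) (s t : ℝ) :
    IntervalIntegrable (fun r => b c (v r)) volume s t := by
  borelize E
  have hm : Measurable fun r => b c (v r) := measurable_of_rightCont fun r =>
    hb.continuous.continuousAt.comp_continuousWithinAt (hx.rightCont r)
  exact (intervalIntegrable_const (c := B)).mono_fun' hm.aestronglyMeasurable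
    (Eventually.of_forall fun r => hb.norm_le _)

variable [CompactSpace S] [CompleteSpace E]

theorem IsDrivenPath.hasDerivWithinAt (hx : IsDrivenPath b v x₀ x)
    (hb : Continuous fun p : E × S => b p.1 p.2) {s : ℝ} (hs : 0 ≤ s) :
    HasDerivWithinAt x (-b (x s) (v s)) (Set.Ici s) s := by
  borelize E
  have hrc : ∀ r, ContinuousWithinAt (fun r => b (x r) (v r)) (Set.Ici r) r := fun r =>
    hb.continuousAt.comp_continuousWithinAt (hx.cont.continuousWithinAt.prodMk (hx.rightCont r))
  have hint : HasDerivWithinAt (fun r : ℝ => ∫ u in (0 : ℝ)..r, b (x u) (v u))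
      (b (x s) (v s)) (Set.Ici s) s :=
    intervalIntegral.integral_hasDerivWithinAt_right (hx.intervalIntegrable hb 0 s)
      (measurable_of_rightCont hrc).stronglyMeasurable.stronglyMeasurableAtFilter
      ((hrc s).mono Set.Ioi_subset_Ici_self)
  exact (hint.const_sub x₀).congr (fun r hr => hx.eqn r (hs.trans hr)) (hx.eqn s hs)

theorem IsDrivenPath.hasDerivWithinAt_norm_sq_sub (hx : IsDrivenPath b v x₀ x)
    (hb : Continuous fun p : E × S => b p.1 p.2) (c : E) {s : ℝ} (hs : 0 ≤ s) :
    HasDerivWithinAt (fun r => ‖x r - c‖ ^ 2) (-2 * inner ℝ (x s - c) (b (x s) (v s)))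
      (Set.Ici s) s := by
  convert! ((hx.hasDerivWithinAt hb hs).sub_const c).norm_sq using 1
  rw [inner_neg_right]
  ring

theorem IsDrivenPath.norm_sub_le (hx : IsDrivenPath b v x₀ x)
    (hb : Continuous fun p : E × S => b p.1 p.2) {M s t : ℝ} (hs : 0 ≤ s) (hst : s ≤ t)
    (hM : ∀ r ∈ Set.Ioc s t, ‖b (x r) (v r)‖ ≤ M) : ‖x t - x s‖ ≤ M * (t - s) := by
  have hincr : x t - x s = ∫ r in s..t, -b (x r) (v r) :=
    (intervalIntegral.integral_eq_sub_of_hasDeriv_right_of_le hst hx.cont.continuousOn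
      (fun r hr => (hx.hasDerivWithinAt hb (hs.trans hr.1.le)).mono Set.Ioi_subset_Ici_self)
      (hx.intervalIntegrable hb s t).neg).symm
  rw [hincr, ← abs_of_nonneg (sub_nonneg.2 hst)]
  refine intervalIntegral.norm_integral_le_of_norm_le_const fun r hr => ?_
  rw [norm_neg]
  exact hM r (Set.uIoc_of_le hst ▸ hr)

theorem IsDrivenPath.norm_sq_sub_le (hx : IsDrivenPath b v x₀ x) (hb : IsDissipativeAt b c κ B)
    {t : ℝ} (ht : 0 ≤ t) :
    ‖x t - c‖ ^ 2 ≤ Real.exp (-κ * t) * ‖x₀ - c‖ ^ 2 + B ^ 2 / κ ^ 2 := by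
  have hx0 : x 0 = x₀ := by simpa using hx.eqn 0 le_rfl
  have hgronwall := le_gronwallBound_of_liminf_deriv_right_le (f := fun r => ‖x r - c‖ ^ 2)
    (a := 0) (b := t) (K := -κ) (ε := B ^ 2 / κ) (by have := hx.cont; fun_prop)
    (fun r hr _ => (hx.hasDerivWithinAt_norm_sq_sub hb.cont c hr.1).liminf_right_slope_le)
    le_rfl (fun r _ => hb.neg_two_inner_le (x r) (v r)) t (Set.right_mem_Icc.2 ht)
  rw [gronwallBound_of_K_ne_0 (neg_ne_zero.2 hb.pos.ne'), hx0, sub_zero] at hgronwall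
  have hrem : B ^ 2 / κ / -κ * (Real.exp (-κ * t) - 1) =
      B ^ 2 / κ ^ 2 - B ^ 2 / κ ^ 2 * Real.exp (-κ * t) := by
    have := hb.pos.ne'
    field_simp
    ring
  have : 0 ≤ B ^ 2 / κ ^ 2 * Real.exp (-κ * t) := by positivity
  linarith

theorem IsDrivenPath.norm_sub_le_absorbingRadius (hx : IsDrivenPath b v x₀ x)
    (hb : IsDissipativeAt b c κ B) {s t : ℝ} (hs : 0 ≤ s)
    (hx₀ : Real.exp (-κ * s) * ‖x₀ - c‖ ^ 2 ≤ 1) (hst : s ≤ t) :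
    ‖x t - c‖ ≤ absorbingRadius κ B := by
  refine le_of_sq_le_sq ?_ (absorbingRadius_nonneg κ B)
  rw [absorbingRadius_sq]
  have hexp : Real.exp (-κ * t) * ‖x₀ - c‖ ^ 2 ≤ Real.exp (-κ * s) * ‖x₀ - c‖ ^ 2 := by
    gcongr ?_ * _
    exact Real.exp_le_exp.2 (mul_le_mul_of_nonpos_left hst (neg_nonpos.2 hb.pos.le))
  linarith [hx.norm_sq_sub_le hb (hs.trans hst)]

theorem IsDrivenPath.norm_sq_sub_step_le (hx : IsDrivenPath b v x₀ x)
    (hb : IsDissipativeAt b c κ B) {A M s h : ℝ} (hs : 0 ≤ s) (hh : 0 ≤ h)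
    (hA : ∀ r, s ≤ r → ‖x r - c‖ ≤ A) (hM : ∀ r, s ≤ r → ‖b (x r) (v r)‖ ≤ M) :
    ‖x (s + h) - c‖ ^ 2 ≤ (1 - 2 * κ * h) * ‖x s - c‖ ^ 2 + (4 * κ * A + 2 * B) * M * h ^ 2 -
      2 * inner ℝ (x s - c) (∫ r in s..(s + h), b c (v r)) := by
  have hle : s ≤ s + h := le_add_of_nonneg_right hh
  have hM0 : 0 ≤ M := (norm_nonneg _).trans (hM s le_rfl)
  have hdriver := hx.intervalIntegrable_driver hb s (s + h)
  have hinner : IntervalIntegrable (fun r => inner ℝ (x s - c) (b c (v r))) volume s (s + h) :=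
    ⟨hdriver.1.const_inner _, hdriver.2.const_inner _⟩
  have hfrozen : ∀ r ∈ Set.Ioo s (s + h), -2 * inner ℝ (x r - c) (b (x r) (v r)) ≤
      (-2 * κ * ‖x s - c‖ ^ 2 + (4 * κ * A + 2 * B) * (M * h)) -
        2 * inner ℝ (x s - c) (b c (v r)) := fun r hr => by
    have hmove : ‖x r - x s‖ ≤ M * h :=
      (hx.norm_sub_le hb.cont hs hr.1.le fun u hu => hM u hu.1.le).trans
        (mul_le_mul_of_nonneg_left (by linarith [hr.2]) hM0)
    have := hb.neg_two_inner_le_frozen (hA r hr.1.le) (hA s le_rfl) hmove (v r)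
    linarith
  have hintegrate := intervalIntegral.sub_le_integral_of_hasDeriv_right_of_le hle
    (g := fun r => ‖x r - c‖ ^ 2) (by have := hx.cont; fun_prop)
    (fun r hr => (hx.hasDerivWithinAt_norm_sq_sub hb.cont c (hs.trans hr.1.le)).mono
      Set.Ioi_subset_Ici_self)
    ((intervalIntegrable_iff_integrableOn_Icc_of_le hle).1
      (intervalIntegrable_const.sub (hinner.const_mul 2))) hfrozen
  rw [intervalIntegral.integral_sub intervalIntegrable_const (hinner.const_mul 2),
    intervalIntegral.integral_const, intervalIntegral.integral_const_mul, add_sub_cancel_left,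
    smul_eq_mul] at hintegrate
  have hcomm : ∫ r in s..(s + h), inner ℝ (x s - c) (b c (v r)) =
      inner ℝ (x s - c) (∫ r in s..(s + h), b c (v r)) :=
    (innerSL ℝ (x s - c)).intervalIntegral_comp_comm hdriver
  rw [hcomm] at hintegrate
  linarith

end DrivenPath

section TimeChange

/-- `τ` is the time change `t ↦ ∫₀ᵗ m(s) ds` with a positive, continuous, non-decreasing speed `m`.
The fast time elapsed between `s` and `t` is then `∫ u in s..t, m u`. -/
structure IsTimeChange (τ : ℝ≥0 → ℝ≥0) (m : ℝ → ℝ) : Prop where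
  cont : Continuous m
  pos : ∀ r, 0 < m r
  mono : Monotone m
  coe_eq : ∀ t : ℝ≥0, (τ t : ℝ) = ∫ r in (0 : ℝ)..t, m r

namespace IsTimeChange

variable {τ : ℝ≥0 → ℝ≥0} {m : ℝ → ℝ}

theorem mul_sub_le_integral (hτ : IsTimeChange τ m) {s t : ℝ} (h : s ≤ t) :
    m s * (t - s) ≤ ∫ u in s..t, m u := by
  have := intervalIntegral.integral_mono_on (μ := volume) h (intervalIntegrable_const (c := m s))
    (hτ.cont.intervalIntegrable s t) fun u hu => hτ.mono hu.1
  simpa [mul_comm] using this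

theorem integral_le_mul_sub (hτ : IsTimeChange τ m) {s t : ℝ} (h : s ≤ t) :
    ∫ u in s..t, m u ≤ m t * (t - s) := by
  have := intervalIntegral.integral_mono_on (μ := volume) h (hτ.cont.intervalIntegrable s t)
    (intervalIntegrable_const (c := m t)) fun u hu => hτ.mono hu.2
  simpa [mul_comm] using this

theorem integral_nonneg (hτ : IsTimeChange τ m) {s t : ℝ} (h : s ≤ t) : 0 ≤ ∫ u in s..t, m u :=
  intervalIntegral.integral_nonneg h fun u _ => (hτ.pos u).le

theorem apply_eq_add (hτ : IsTimeChange τ m) {s t : ℝ} (hs : 0 ≤ s) (h : s ≤ t) :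
    τ t.toNNReal = τ s.toNNReal + (∫ u in s..t, m u).toNNReal := by
  rw [← NNReal.coe_inj, NNReal.coe_add, hτ.coe_eq, hτ.coe_eq, Real.coe_toNNReal t (hs.trans h),
    Real.coe_toNNReal s hs, Real.coe_toNNReal _ (hτ.integral_nonneg h),
    intervalIntegral.integral_add_adjacent_intervals (hτ.cont.intervalIntegrable _ _)
      (hτ.cont.intervalIntegrable _ _)]

theorem monotone (hτ : IsTimeChange τ m) : Monotone τ := fun s t h => by
  have := hτ.apply_eq_add s.coe_nonneg (NNReal.coe_le_coe.2 h)
  simp only [Real.toNNReal_coe] at this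
  exact this ▸ le_self_add

theorem continuous (hτ : IsTimeChange τ m) : Continuous τ := by
  rw [NNReal.isEmbedding_coe.continuous_iff]
  simp only [Function.comp_def, hτ.coe_eq]
  exact (intervalIntegral.continuous_primitive (fun _ _ => hτ.cont.intervalIntegrable _ _) 0).comp
    NNReal.continuous_coe

theorem continuous_integral (hτ : IsTimeChange τ m) (s : ℝ) :
    Continuous fun t => ∫ u in s..t, m u :=
  intervalIntegral.continuous_primitive (fun _ _ => hτ.cont.intervalIntegrable _ _) s

variable {E : Type*} [NormedAddCommGroup E] [NormedSpace ℝ E]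

theorem norm_smul_integral_comp_le (hτ : IsTimeChange τ m) {g : ℝ → E}
    (hg : StronglyMeasurable g) {B : ℝ} (hB : ∀ u, ‖g u‖ ≤ B) {s t : ℝ} (hst : s ≤ t) :
    m s * ‖∫ r in s..t, g (∫ u in s..r, m u)‖ ≤
      ‖∫ u in (0 : ℝ)..∫ u in s..t, m u, g u‖ + (m t - m s) * B * (t - s) := by
  let T : ℝ → ℝ := fun r => ∫ u in s..r, m u
  have hT : Continuous T := hτ.continuous_integral s
  have hint : IntervalIntegrable (fun r => g (T r)) volume s t :=
    (intervalIntegrable_const (c := B)).mono_fun'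
      (hg.comp_measurable hT.measurable).aestronglyMeasurable (Eventually.of_forall fun r => hB _)
  have hsubst : ∫ r in s..t, m r • g (T r) = ∫ u in (0 : ℝ)..T t, g u := by
    have := intervalIntegral.integral_deriv_smul_comp_of_deriv_nonneg (a := s) (b := t) (f := T)
      (f' := m) (g := g) hT.continuousOn
      (fun r _ => (hτ.cont.integral_hasStrictDerivAt s r).hasDerivAt) fun r _ => (hτ.pos r).le
    simpa [T] using this
  have hfreeze : m s • ∫ r in s..t, g (T r) =
      (∫ u in (0 : ℝ)..T t, g u) - ∫ r in s..t, (m r - m s) • g (T r) := by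
    have hint₁ : IntervalIntegrable (fun r => m r • g (T r)) volume s t :=
      hint.continuousOn_smul hτ.cont.continuousOn
    have hint₂ : IntervalIntegrable (fun r => (m r - m s) • g (T r)) volume s t :=
      hint.continuousOn_smul (hτ.cont.sub continuous_const).continuousOn
    rw [← hsubst, ← intervalIntegral.integral_smul, ← intervalIntegral.integral_sub hint₁ hint₂]
    simp only [sub_smul, sub_sub_cancel]
  have herror : ‖∫ r in s..t, (m r - m s) • g (T r)‖ ≤ (m t - m s) * B * (t - s) := by
    rw [← abs_of_nonneg (sub_nonneg.2 hst)]
    refine intervalIntegral.norm_integral_le_of_norm_le_const fun r hr => ?_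
    rw [Set.uIoc_of_le hst] at hr
    rw [norm_smul, Real.norm_of_nonneg (sub_nonneg.2 (hτ.mono hr.1.le))]
    exact mul_le_mul (sub_le_sub_right (hτ.mono hr.2) _) (hB _) (norm_nonneg _)
      (sub_nonneg.2 (hτ.mono hst))
  rw [← Real.norm_of_nonneg (hτ.pos s).le, ← norm_smul, Real.norm_of_nonneg (hτ.pos s).le, hfreeze]
  exact (norm_sub_le _ _).trans (by gcongr)

end IsTimeChange

end TimeChange

theorem integral_inner_intervalIntegral {α E : Type*} [MeasurableSpace α] [NormedAddCommGroup E]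
    [InnerProductSpace ℝ E] [CompleteSpace E] [SecondCountableTopology E] [MeasurableSpace E]
    [BorelSpace E] {ν : Measure α} [SFinite ν] {Z : α → E} (hZ : Integrable Z ν) {Y : ℝ → α → E}
    (hY : Measurable (Function.uncurry Y)) {B : ℝ} (hB : ∀ r a, ‖Y r a‖ ≤ B) (s t : ℝ) :
    ∫ a, inner ℝ (Z a) (∫ r in s..t, Y r a) ∂ν = ∫ r in s..t, ∫ a, inner ℝ (Z a) (Y r a) ∂ν := by
  have hcomm : ∀ a, inner ℝ (Z a) (∫ r in s..t, Y r a) = ∫ r in s..t, inner ℝ (Z a) (Y r a) :=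
    fun a => ((innerSL ℝ (Z a)).intervalIntegral_comp_comm
      ((intervalIntegrable_const (c := B)).mono_fun'
        (hY.comp (measurable_id.prodMk measurable_const)).aestronglyMeasurable
        (Eventually.of_forall fun r => hB r a))).symm
  simp only [hcomm]
  refine (intervalIntegral_integral_swap ?_).symm
  have : IsFiniteMeasure (volume.restrict (Set.uIoc s t)) :=
    isFiniteMeasure_restrict.2 measure_Ioc_lt_top.ne
  have hbound : Integrable (fun p : ℝ × α => ‖Z p.2‖ * B)
      ((volume.restrict (Set.uIoc s t)).prod ν) := (hZ.norm.mul_const B).comp_snd _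
  refine hbound.mono' (hZ.aestronglyMeasurable.comp_snd.inner hY.aestronglyMeasurable)
    (Eventually.of_forall fun p => (norm_inner_le_norm _ _).trans ?_)
  exact mul_le_mul_of_nonneg_left (hB _ _) (norm_nonneg _)

section Block

variable {S Ω E : Type*} [TopologicalSpace S] [MeasurableSpace S] [mΩ : MeasurableSpace Ω]
    {𝓕 : Filtration ℝ≥0 mΩ} {P : Kernel S Ω} {V : ℝ≥0 → Ω → S} {τ : ℝ≥0 → ℝ≥0} {m : ℝ → ℝ}

theorem IsFellerProcess.measurable_comp_clock [TopologicalSpace.PseudoMetrizableSpace S]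
    [BorelSpace S] (hV : IsFellerProcess 𝓕 P V) (hτ : IsTimeChange τ m) :
    Measurable fun p : ℝ × Ω => V (τ p.1.toNNReal) p.2 :=
  hV.measurable_uncurry.comp
    ((hτ.continuous.measurable.comp measurable_fst.real_toNNReal).prodMk measurable_snd)

variable [CompactSpace S] [OpensMeasurableSpace S] [NormedAddCommGroup E] {G : S → E} {s t : ℝ}

theorem IsFellerProcess.norm_integral_transition_clock_le [NormedSpace ℝ E] [CompleteSpace E]
    [SecondCountableTopology E] (hV : IsFellerProcess 𝓕 P V) (hτ : IsTimeChange τ m)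
    (hG : Continuous G) {B : ℝ} (hB : ∀ y, ‖G y‖ ≤ B) (hst : s ≤ t) {L : ℝ} (hL : 0 < L)
    (hLs : L ≤ m s * (t - s)) (x : S) :
    ‖∫ r in s..t, transition P V G (∫ u in s..r, m u).toNNReal x‖ ≤
      (t - s) * (B * ((m t - m s) / m s) + m t / m s * averagingModulus P V G L) := by
  have := hV.isProb
  borelize E
  have hms := hτ.pos s
  have hg : Measurable fun u : ℝ => transition P V G u.toNNReal x :=
    (hV.measurable_uncurry_transition hG).comp (measurable_real_toNNReal.prodMk measurable_const)
  have hfreeze := hτ.norm_smul_integral_comp_le hg.stronglyMeasurable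
    (fun u => norm_transition_le hB _ x) hst
  have havg : ‖∫ u in (0 : ℝ)..∫ u in s..t, m u, transition P V G u.toNNReal x‖ ≤
      m t * (t - s) * averagingModulus P V G L :=
    (norm_integral_transition_le_averagingModulus hB hL
      (hLs.trans (hτ.mul_sub_le_integral hst)) x).trans
      (mul_le_mul_of_nonneg_right (hτ.integral_le_mul_sub hst) (averagingModulus_nonneg L))
  rw [← mul_le_mul_iff_right₀ hms]
  calc _ ≤ m t * (t - s) * averagingModulus P V G L + (m t - m s) * B * (t - s) := by linarith
    _ = _ := by field_simp; ring

variable [InnerProductSpace ℝ E] [CompleteSpace E] [SecondCountableTopology E]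
    [MeasurableSpace E] [BorelSpace E]

theorem IsFellerProcess.integral_inner_integral_clock
    [TopologicalSpace.PseudoMetrizableSpace S] [BorelSpace S]
    (hV : IsFellerProcess 𝓕 P V) (hτ : IsTimeChange τ m)
    (hG : Continuous G) (hs : 0 ≤ s) (hst : s ≤ t) (x : S) {Z : Ω → E}
    (hZ : Measurable[𝓕 (τ s.toNNReal)] Z) (hZint : Integrable Z (P x)) :
    ∫ ω, inner ℝ (Z ω) (∫ r in s..t, G (V (τ r.toNNReal) ω)) ∂(P x) =
      ∫ ω, inner ℝ (Z ω) (∫ r in s..t,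
        transition P V G (∫ u in s..r, m u).toNNReal (V (τ s.toNNReal) ω)) ∂(P x) := by
  have := hV.isProb
  obtain ⟨B, -, hB⟩ := exists_norm_le_of_continuous hG
  have hpath : Measurable (Function.uncurry fun (r : ℝ) ω => G (V (τ r.toNNReal) ω)) :=
    hG.measurable.comp (hV.measurable_comp_clock hτ)
  have hcond : Measurable (Function.uncurry fun (r : ℝ) ω =>
      transition P V G (∫ u in s..r, m u).toNNReal (V (τ s.toNNReal) ω)) :=
    (hV.measurable_uncurry_transition hG).comp
      (((hτ.continuous_integral s).measurable.comp measurable_fst).real_toNNReal.prodMk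
        ((hV.measurable _).comp measurable_snd))
  rw [integral_inner_intervalIntegral hZint hpath fun r ω => hB _,
    integral_inner_intervalIntegral hZint hcond fun r ω => norm_transition_le hB _ _]
  refine intervalIntegral.integral_congr fun r hr => ?_
  rw [Set.uIcc_of_le hst] at hr
  simp only [hτ.apply_eq_add hs hr.1]
  exact hV.integral_inner_comp_add hG x _ _ hZ hZint

theorem IsFellerProcess.abs_integral_inner_integral_clock_le
    [TopologicalSpace.PseudoMetrizableSpace S] [BorelSpace S]
    (hV : IsFellerProcess 𝓕 P V) (hτ : IsTimeChange τ m)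
    (hG : Continuous G) (hs : 0 ≤ s) (hst : s ≤ t) {C : ℝ}
    (hC : ∀ x, ‖∫ r in s..t, transition P V G (∫ u in s..r, m u).toNNReal x‖ ≤ C)
    {Z : Ω → E} (hZ : Measurable[𝓕 (τ s.toNNReal)] Z) {A : ℝ} (hA : ∀ ω, ‖Z ω‖ ≤ A) (x : S) :
    |∫ ω, inner ℝ (Z ω) (∫ r in s..t, G (V (τ r.toNNReal) ω)) ∂(P x)| ≤ A * C := by
  have := hV.isProb
  have hZint : Integrable Z (P x) := Integrable.of_bound
    (hZ.mono (𝓕.le _) le_rfl).aestronglyMeasurable A (Eventually.of_forall hA)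
  rw [hV.integral_inner_integral_clock hτ hG hs hst x hZ hZint]
  have := norm_integral_le_of_norm_le_const (μ := P x) (C := A * C)
    (f := fun ω => inner ℝ (Z ω) (∫ r in s..t,
      transition P V G (∫ u in s..r, m u).toNNReal (V (τ s.toNNReal) ω)))
    (Eventually.of_forall fun ω => (norm_inner_le_norm _ _).trans
      (mul_le_mul (hA ω) (hC _) (norm_nonneg _) ((norm_nonneg _).trans (hA ω))))
  rwa [probReal_univ, mul_one] at this

end Block

section Energy

/-- The process `X` solves `dX_t = -b(X_t, V_{τ(t)}) dt`, `X_0 = x₀`, along every path, and `X_t` is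
measurable with respect to `𝓕_{τ(t)}`. -/
structure IsDrivenProcess {S Ω E : Type*} [TopologicalSpace S] [mΩ : MeasurableSpace Ω]
    [NormedAddCommGroup E] [NormedSpace ℝ E] [MeasurableSpace E] (𝓕 : Filtration ℝ≥0 mΩ)
    (V : ℝ≥0 → Ω → S) (b : E → S → E) (τ : ℝ≥0 → ℝ≥0) (x₀ : E) (X : ℝ≥0 → Ω → E) : Prop where
  adapted : ∀ t, Measurable[𝓕 (τ t)] (X t)
  isDrivenPath : ∀ ω,
    IsDrivenPath b (fun r => V (τ r.toNNReal) ω) x₀ fun r => X r.toNNReal ω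

theorem IsDrivenProcess.measurable {S Ω E : Type*} [TopologicalSpace S] [mΩ : MeasurableSpace Ω]
    [NormedAddCommGroup E] [NormedSpace ℝ E] [MeasurableSpace E] {𝓕 : Filtration ℝ≥0 mΩ}
    {V : ℝ≥0 → Ω → S} {b : E → S → E} {τ : ℝ≥0 → ℝ≥0} {x₀ : E} {X : ℝ≥0 → Ω → E}
    (hX : IsDrivenProcess 𝓕 V b τ x₀ X) (t : ℝ≥0) : Measurable (X t) :=
  (hX.adapted t).mono (𝓕.le _) le_rfl

/-- The step size of the energy recursion in units of `√ε`, where `ε` is the learning rate. It is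
kept below `1 / (2κ)`, where the contraction factor `1 - 2κh` of a step of size `h` changes sign. -/
def stepScale (κ : ℝ) : ℝ :=
  min 1 (1 / (2 * κ))

theorem stepScale_pos {κ : ℝ} (hκ : 0 < κ) : 0 < stepScale κ :=
  lt_min one_pos (by positivity)

theorem stepScale_le_one (κ : ℝ) : stepScale κ ≤ 1 :=
  min_le_left _ _

theorem two_mul_mul_stepScale_le_one {κ : ℝ} (hκ : 0 < κ) : 2 * κ * stepScale κ ≤ 1 :=
  (le_div_iff₀' (by positivity)).1 (min_le_right _ _)

/-- The mean-square distance to `c`, up to a constant, which remains at learning rate `ε` after the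
initial condition is forgotten: the discretization error `√ε` of the energy recursion, and the
averaging error of the observable `G = b(c, ·)` on the pieces of the recursion, whose length in fast
time is of order `1 / √ε`. -/
def averagingError {S Ω E : Type*} [MeasurableSpace S] [MeasurableSpace Ω] [NormedAddCommGroup E]
    [NormedSpace ℝ E] (P : Kernel S Ω) (V : ℝ≥0 → Ω → S) (G : S → E) (κ ε : ℝ) : ℝ :=
  √ε + averagingModulus P V G (stepScale κ / 2 * (√ε)⁻¹)

/-- The constant of the energy estimate for a vector field which is bounded by `B` at its centre and
by `M` on the absorbing ball. -/
def energyConst (κ B M : ℝ) : ℝ :=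
  absorbingRadius κ B ^ 2 + (4 * κ * absorbingRadius κ B + 2 * B) * M / (2 * κ) +
    absorbingRadius κ B * (B + 2) / κ

theorem energyConst_pos {κ B M : ℝ} (hκ : 0 < κ) (hB : 0 ≤ B) (hM : 0 ≤ M) :
    0 < energyConst κ B M := by
  have hA := absorbingRadius_nonneg κ B
  have hA2 : 0 < absorbingRadius κ B ^ 2 := by rw [absorbingRadius_sq]; positivity
  unfold energyConst
  positivity

theorem IsDissipativeAt.energyConst_pos {S E : Type*} [TopologicalSpace S] [Nonempty S]
    [NormedAddCommGroup E] [InnerProductSpace ℝ E] {b : E → S → E} {c : E} {κ B M : ℝ}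
    (hb : IsDissipativeAt b c κ B) (hM : ∀ x, ‖x - c‖ ≤ absorbingRadius κ B → ∀ y, ‖b x y‖ ≤ M) :
    0 < energyConst κ B M :=
  have y := Classical.arbitrary S
  SGP.energyConst_pos hb.pos ((norm_nonneg _).trans (hb.norm_le y))
    ((norm_nonneg _).trans (hM c (by simpa using absorbingRadius_nonneg κ B) y))

theorem le_energyConst_mul {κ B M p h u R : ℝ} (hκ : 0 < κ) (hB : 0 ≤ B) (hM : 0 ≤ M)
    (hp : 0 ≤ p) (hh : 0 ≤ h) (hu : 0 ≤ u) (hR : 0 ≤ R) :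
    p * absorbingRadius κ B ^ 2 +
        ((4 * κ * absorbingRadius κ B + 2 * B) * M / (2 * κ) * h +
          absorbingRadius κ B / κ * (B * u + 2 * R)) ≤
      energyConst κ B M * (p + u + (h + R)) := by
  have hA := absorbingRadius_nonneg κ B
  unfold energyConst
  set A := absorbingRadius κ B
  set D := (4 * κ * A + 2 * B) * M / (2 * κ)
  have : 0 ≤ D := by positivity
  have hnonneg : 0 ≤ A ^ 2 * (h + u + R) + D * (p + u + R) +
      A / κ * ((B + 2) * (p + h) + 2 * u + B * R) := by positivity
  have hexpand : (A ^ 2 + D + A * (B + 2) / κ) * (p + u + (h + R)) =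
      p * A ^ 2 + (D * h + A / κ * (B * u + 2 * R)) + (A ^ 2 * (h + u + R) + D * (p + u + R) +
        A / κ * ((B + 2) * (p + h) + 2 * u + B * R)) := by ring
  linarith

theorem integrable_norm_sq_sub_of_norm_sub_le {Ω E : Type*} [MeasurableSpace Ω]
    [NormedAddCommGroup E] [MeasurableSpace E] [BorelSpace E] {Q : Measure Ω}
    [IsFiniteMeasure Q] {X : Ω → E} (hX : Measurable X) {c : E} {A : ℝ}
    (hA : ∀ ω, ‖X ω - c‖ ≤ A) : Integrable (fun ω => ‖X ω - c‖ ^ 2) Q := by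
  refine Integrable.of_bound (C := A ^ 2)
    ((by fun_prop : Measurable fun x => ‖x - c‖ ^ 2).comp hX).aestronglyMeasurable
    (Eventually.of_forall fun ω => ?_)
  rw [norm_pow, norm_norm]
  exact pow_le_pow_left₀ (norm_nonneg _) (hA ω) 2

theorem le_geometric_of_step {e : ℕ → ℝ} {q D : ℝ} (hq : 0 ≤ q) (hD : 0 ≤ D) {n : ℕ}
    (hstep : ∀ k < n, e (k + 1) ≤ q * e k + (1 - q) * D) : e n ≤ q ^ n * e 0 + D := by
  induction n with
  | zero => simpa using hD
  | succ n ih =>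
    calc e (n + 1) ≤ q * e n + (1 - q) * D := hstep n n.lt_succ_self
      _ ≤ q * (q ^ n * e 0 + D) + (1 - q) * D := by
        gcongr
        exact ih fun k hk => hstep k (hk.trans n.lt_succ_self)
      _ = q ^ (n + 1) * e 0 + D := by ring

theorem exists_nat_mul_eq {a b : ℝ} (hb : 0 < b) (hab : b ≤ a) :
    ∃ (n : ℕ) (h : ℝ), n * h = a ∧ h ≤ b ∧ b / 2 ≤ h := by
  have ha : 0 < a := hb.trans_le hab
  have hone : 1 ≤ a / b := (one_le_div hb).2 hab
  have hn : 0 < (⌈a / b⌉₊ : ℝ) := by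
    exact_mod_cast Nat.ceil_pos.2 (by linarith)
  refine ⟨⌈a / b⌉₊, a / ⌈a / b⌉₊, by field_simp, ?_, ?_⟩
  · rw [div_le_iff₀ hn, ← div_le_iff₀' hb]
    exact Nat.le_ceil _
  · have hceil : (⌈a / b⌉₊ : ℝ) ≤ 2 * (a / b) := by
      linarith [(Nat.ceil_lt_add_one (a := a / b) (by linarith)).le]
    rw [le_div_iff₀ hn]
    calc b / 2 * (⌈a / b⌉₊ : ℝ) ≤ b / 2 * (2 * (a / b)) := by gcongr
      _ = a := by field_simp

variable {S Ω E : Type*} [TopologicalSpace S] [CompactSpace S] [mΩ : MeasurableSpace Ω]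
    [NormedAddCommGroup E] [InnerProductSpace ℝ E] [SecondCountableTopology E] [CompleteSpace E]
    {𝓕 : Filtration ℝ≥0 mΩ} {V : ℝ≥0 → Ω → S} {b : E → S → E} {c x₀ : E} {κ B : ℝ}
    {τ : ℝ≥0 → ℝ≥0} {m : ℝ → ℝ}

theorem IsFellerProcess.norm_integral_transition_piece_le [MeasurableSpace S]
    [OpensMeasurableSpace S] {P : Kernel S Ω} (hV : IsFellerProcess 𝓕 P V)
    (hτ : IsTimeChange τ m) (hb : IsDissipativeAt b c κ B) {h s s' t L : ℝ} (hh : 0 ≤ h)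
    (hs : s ≤ s') (ht : s' + h ≤ t) (hL : 0 < L) (hLs : L ≤ m s * h) (hm : m t ≤ 2 * m s)
    (x : S) :
    ‖∫ r in s'..(s' + h), transition P V (b c) (∫ u in s'..r, m u).toNNReal x‖ ≤
      h * (B * ((m t - m s) / m s) + 2 * averagingModulus P V (b c) L) := by
  have hms := hτ.pos s
  have hB : 0 ≤ B := (norm_nonneg _).trans (hb.norm_le x)
  have hle : s' ≤ s' + h := le_add_of_nonneg_right hh
  have hstart : m s ≤ m s' := hτ.mono hs
  have hpiece : m s' ≤ m (s' + h) := hτ.mono hle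
  have hend : m (s' + h) ≤ m t := hτ.mono ht
  have hincr : (m (s' + h) - m s') / m s' ≤ (m t - m s) / m s :=
    div_le_div₀ (by linarith) (by linarith) hms hstart
  have hratio : m (s' + h) / m s' ≤ 2 := (div_le_iff₀ (hτ.pos s')).2 (by linarith)
  have hLs' : L ≤ m s' * (s' + h - s') := by
    rw [add_sub_cancel_left]
    exact hLs.trans (by gcongr)
  refine (hV.norm_integral_transition_clock_le hτ hb.continuous hb.norm_le hle hL hLs' x).trans ?_
  rw [add_sub_cancel_left]
  have := averagingModulus_nonneg (P := P) (V := V) (h := b c) L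
  gcongr

variable [MeasurableSpace E] {X : ℝ≥0 → Ω → E}

theorem IsDrivenProcess.norm_sub_le_absorbingRadius (hX : IsDrivenProcess 𝓕 V b τ x₀ X)
    (hb : IsDissipativeAt b c κ B) {s : ℝ} (hs : 0 ≤ s)
    (hx₀ : Real.exp (-κ * s) * ‖x₀ - c‖ ^ 2 ≤ 1) (ω : Ω) {t : ℝ} (hst : s ≤ t) :
    ‖X t.toNNReal ω - c‖ ≤ absorbingRadius κ B :=
  (hX.isDrivenPath ω).norm_sub_le_absorbingRadius hb hs hx₀ hst

variable [BorelSpace E]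

theorem IsDrivenProcess.integrable_norm_sq_sub (hX : IsDrivenProcess 𝓕 V b τ x₀ X)
    (hb : IsDissipativeAt b c κ B) {s : ℝ} (hs : 0 ≤ s)
    (hx₀ : Real.exp (-κ * s) * ‖x₀ - c‖ ^ 2 ≤ 1) {t : ℝ} (hst : s ≤ t) (Q : Measure Ω)
    [IsFiniteMeasure Q] : Integrable (fun ω => ‖X t.toNNReal ω - c‖ ^ 2) Q :=
  integrable_norm_sq_sub_of_norm_sub_le (hX.measurable _) fun ω =>
    hX.norm_sub_le_absorbingRadius hb hs hx₀ ω hst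

variable [TopologicalSpace.PseudoMetrizableSpace S] [MeasurableSpace S] [BorelSpace S]
    {P : Kernel S Ω} {M s : ℝ}

theorem IsDrivenProcess.integral_norm_sq_sub_step_le (hX : IsDrivenProcess 𝓕 V b τ x₀ X)
    (hV : IsFellerProcess 𝓕 P V) (hτ : IsTimeChange τ m) (hb : IsDissipativeAt b c κ B)
    {A C h : ℝ} (hs : 0 ≤ s) (hh : 0 ≤ h) (hA : ∀ ω r, s ≤ r → ‖X r.toNNReal ω - c‖ ≤ A)
    (hM : ∀ ω r, s ≤ r → ‖b (X r.toNNReal ω) (V (τ r.toNNReal) ω)‖ ≤ M)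
    (hC : ∀ x, ‖∫ r in s..(s + h),
      transition P V (b c) (∫ u in s..r, m u).toNNReal x‖ ≤ C) (x : S) :
    ∫ ω, ‖X (s + h).toNNReal ω - c‖ ^ 2 ∂(P x) ≤
      (1 - 2 * κ * h) * ∫ ω, ‖X s.toNNReal ω - c‖ ^ 2 ∂(P x) +
        (4 * κ * A + 2 * B) * M * h ^ 2 + 2 * (A * C) := by
  have := hV.isProb
  have hle : s ≤ s + h := le_add_of_nonneg_right hh
  let W : Ω → ℝ := fun ω => inner ℝ (X s.toNNReal ω - c)
    (∫ r in s..(s + h), b c (V (τ r.toNNReal) ω))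
  have hinit : Integrable (fun ω => ‖X s.toNNReal ω - c‖ ^ 2) (P x) :=
    integrable_norm_sq_sub_of_norm_sub_le (hX.measurable _) fun ω => hA ω s le_rfl
  have hfinal : Integrable (fun ω => ‖X (s + h).toNNReal ω - c‖ ^ 2) (P x) :=
    integrable_norm_sq_sub_of_norm_sub_le (hX.measurable _) fun ω => hA ω (s + h) hle
  have hdrift : Integrable (fun ω => (1 - 2 * κ * h) * ‖X s.toNNReal ω - c‖ ^ 2 +
      (4 * κ * A + 2 * B) * M * h ^ 2) (P x) :=
    (hinit.const_mul _).add (integrable_const _)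
  have hW : Integrable W (P x) := by
    have hdriver : StronglyMeasurable fun ω =>
        ∫ r in s..(s + h), b c (V (τ r.toNNReal) ω) := by
      simp only [intervalIntegral.integral_of_le hle]
      exact ((hb.continuous.measurable.comp
        (hV.measurable_comp_clock hτ)).stronglyMeasurable).integral_prod_left'
    refine Integrable.of_bound (C := A * (B * h))
      (((hX.measurable _).sub_const c).aestronglyMeasurable.inner hdriver.aestronglyMeasurable)
      (Eventually.of_forall fun ω => (norm_inner_le_norm _ _).trans ?_)
    have hbound := intervalIntegral.norm_integral_le_of_norm_le_const (a := s) (b := s + h)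
      (f := fun r : ℝ => b c (V (τ r.toNNReal) ω)) fun r _ => hb.norm_le _
    rw [add_sub_cancel_left, abs_of_nonneg hh] at hbound
    exact mul_le_mul (hA ω s le_rfl) hbound (norm_nonneg _)
      ((norm_nonneg _).trans (hA ω s le_rfl))
  have hpath := integral_mono hfinal (hdrift.sub (hW.const_mul 2)) fun ω =>
    (hX.isDrivenPath ω).norm_sq_sub_step_le hb hs hh (hA ω) (hM ω)
  have hcorr : |∫ ω, W ω ∂(P x)| ≤ A * C := hV.abs_integral_inner_integral_clock_le hτ
    hb.continuous hs hle hC ((hX.adapted _).sub_const c) (fun ω => hA ω s le_rfl) x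
  simp only [Pi.sub_apply] at hpath
  rw [integral_sub hdrift (hW.const_mul 2), integral_add (hinit.const_mul _) (integrable_const _),
    integral_const_mul, integral_const, probReal_univ, one_smul, integral_const_mul] at hpath
  linarith [neg_le_of_abs_le hcorr]

theorem IsDrivenProcess.integral_norm_sq_sub_pieces_le (hX : IsDrivenProcess 𝓕 V b τ x₀ X)
    (hV : IsFellerProcess 𝓕 P V) (hτ : IsTimeChange τ m) (hb : IsDissipativeAt b c κ B)
    (hM : ∀ x, ‖x - c‖ ≤ absorbingRadius κ B → ∀ y, ‖b x y‖ ≤ M) (hs : 0 ≤ s)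
    (hx₀ : Real.exp (-κ * s) * ‖x₀ - c‖ ^ 2 ≤ 1) {h L : ℝ} {n : ℕ} (hh : 0 ≤ h)
    (hκh : 2 * κ * h ≤ 1) (hL : 0 < L) (hLs : L ≤ m s * h) (hm : m (s + n * h) ≤ 2 * m s)
    (x : S) :
    ∫ ω, ‖X (s + n * h).toNNReal ω - c‖ ^ 2 ∂(P x) ≤
      (1 - 2 * κ * h) ^ n * ∫ ω, ‖X s.toNNReal ω - c‖ ^ 2 ∂(P x) +
        ((4 * κ * absorbingRadius κ B + 2 * B) * M / (2 * κ) * h +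
          absorbingRadius κ B / κ * (B * ((m (s + n * h) - m s) / m s) +
            2 * averagingModulus P V (b c) L)) := by
  let A := absorbingRadius κ B
  let u := (m (s + n * h) - m s) / m s
  let R := averagingModulus P V (b c) L
  let e : ℕ → ℝ := fun k => ∫ ω, ‖X (s + k * h).toNNReal ω - c‖ ^ 2 ∂(P x)
  have hκ := hb.pos
  have hball : ∀ ω r, s ≤ r → ‖X r.toNNReal ω - c‖ ≤ A := fun ω r hr =>
    hX.norm_sub_le_absorbingRadius hb hs hx₀ ω hr
  have hA : 0 ≤ A := absorbingRadius_nonneg κ B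
  have hB : 0 ≤ B := (norm_nonneg _).trans (hb.norm_le x)
  have hM0 : 0 ≤ M := (norm_nonneg _).trans (hM c (by simpa using hA) x)
  have hu : 0 ≤ u := div_nonneg
    (sub_nonneg.2 (hτ.mono (le_add_of_nonneg_right (by positivity)))) (hτ.pos s).le
  have hR : 0 ≤ R := averagingModulus_nonneg L
  have hstep : ∀ k < n, e (k + 1) ≤ (1 - 2 * κ * h) * e k + (1 - (1 - 2 * κ * h)) *
      ((4 * κ * A + 2 * B) * M / (2 * κ) * h + A / κ * (B * u + 2 * R)) := fun k hk => by
    have hsk : s ≤ s + k * h := le_add_of_nonneg_right (by positivity)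
    have hsucc : s + k * h + h = s + (k + 1 : ℕ) * h := by push_cast; ring
    have hkn : s + k * h + h ≤ s + n * h := by rw [hsucc]; gcongr; exact hk
    have hle := hX.integral_norm_sq_sub_step_le hV hτ hb (hs.trans hsk) hh
      (fun ω r hr => hball ω r (hsk.trans hr))
      (fun ω r hr => hM _ (hball ω r (hsk.trans hr)) _)
      (hV.norm_integral_transition_piece_le hτ hb hh hsk hkn hL hLs hm) x
    rw [hsucc] at hle
    refine hle.trans (le_of_eq ?_)
    simp only [e, u, R]
    field_simp
    ring
  simpa only [e, Nat.cast_zero, zero_mul, add_zero] using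
    le_geometric_of_step (e := e) (by linarith) (by positivity) hstep

theorem IsDrivenProcess.integral_norm_sq_sub_le_energyConst_mul
    (hX : IsDrivenProcess 𝓕 V b τ x₀ X) (hV : IsFellerProcess 𝓕 P V) (hτ : IsTimeChange τ m)
    (hb : IsDissipativeAt b c κ B) (hM : ∀ x, ‖x - c‖ ≤ absorbingRadius κ B → ∀ y, ‖b x y‖ ≤ M)
    (hs : 0 ≤ s) (hx₀ : Real.exp (-κ * s) * ‖x₀ - c‖ ^ 2 ≤ 1) {h L : ℝ} {n : ℕ} (hh : 0 ≤ h)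
    (hκh : 2 * κ * h ≤ 1) (hL : 0 < L) (hLs : L ≤ m s * h) (hm : m (s + n * h) ≤ 2 * m s)
    (x : S) :
    ∫ ω, ‖X (s + n * h).toNNReal ω - c‖ ^ 2 ∂(P x) ≤ energyConst κ B M *
      (Real.exp (-2 * κ * (n * h)) + (m (s + n * h) - m s) / m s +
        (h + averagingModulus P V (b c) L)) := by
  have := hV.isProb
  have hB : 0 ≤ B := (norm_nonneg _).trans (hb.norm_le x)
  have hM0 : 0 ≤ M :=
    (norm_nonneg _).trans (hM c (by simpa using absorbingRadius_nonneg κ B) x)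
  have hcontract : (1 - 2 * κ * h) ^ n ≤ Real.exp (-2 * κ * (n * h)) := by
    calc (1 - 2 * κ * h) ^ n ≤ Real.exp (-(2 * κ * h)) ^ n :=
          pow_le_pow_left₀ (by linarith) (Real.one_sub_le_exp_neg _) n
      _ = Real.exp (-2 * κ * (n * h)) := by rw [← Real.exp_nat_mul]; ring_nf
  have hinit : ∫ ω, ‖X s.toNNReal ω - c‖ ^ 2 ∂(P x) ≤ absorbingRadius κ B ^ 2 := by
    have := integral_mono (hX.integrable_norm_sq_sub hb hs hx₀ le_rfl (P x))
      (integrable_const (absorbingRadius κ B ^ 2)) fun ω => pow_le_pow_left₀ (norm_nonneg _)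
        (hX.norm_sub_le_absorbingRadius hb hs hx₀ ω le_rfl) 2
    simpa using this
  have hincr : 0 ≤ (m (s + n * h) - m s) / m s := div_nonneg
    (sub_nonneg.2 (hτ.mono (le_add_of_nonneg_right (by positivity)))) (hτ.pos s).le
  refine (hX.integral_norm_sq_sub_pieces_le hV hτ hb hM hs hx₀ hh hκh hL hLs hm x).trans
    (le_trans ?_ (le_energyConst_mul hb.pos hB hM0 (Real.exp_pos _).le hh hincr
      (averagingModulus_nonneg L)))
  gcongr

theorem IsDrivenProcess.integral_norm_sq_sub_le (hX : IsDrivenProcess 𝓕 V b τ x₀ X)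
    (hV : IsFellerProcess 𝓕 P V) (hτ : IsTimeChange τ m) (hb : IsDissipativeAt b c κ B)
    (hM : ∀ x, ‖x - c‖ ≤ absorbingRadius κ B → ∀ y, ‖b x y‖ ≤ M) (hs : 0 ≤ s)
    (hx₀ : Real.exp (-κ * s) * ‖x₀ - c‖ ^ 2 ≤ 1) {a ε : ℝ} (hms : m s = ε⁻¹) (hε : ε ≤ 1)
    (ha : stepScale κ * √ε ≤ a) (hm : m (s + a) ≤ 2 * m s) (x : S) :
    ∫ ω, ‖X (s + a).toNNReal ω - c‖ ^ 2 ∂(P x) ≤ energyConst κ B M *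
      (Real.exp (-2 * κ * a) + (m (s + a) - m s) / m s + averagingError P V (b c) κ ε) := by
  have hκ := hb.pos
  have hε0 : 0 < ε := inv_pos.1 (hms ▸ hτ.pos s)
  have hscale := stepScale_pos hκ
  have hsqrt : 0 < √ε := Real.sqrt_pos.2 hε0
  obtain ⟨n, h, rfl, hle, hge⟩ := exists_nat_mul_eq (mul_pos hscale hsqrt) ha
  have hh : 0 ≤ h := (by positivity : 0 ≤ stepScale κ * √ε / 2).trans hge
  have hκh : 2 * κ * h ≤ 1 := by
    calc 2 * κ * h ≤ 2 * κ * (stepScale κ * 1) := by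
          gcongr
          exact hle.trans (by gcongr; exact Real.sqrt_le_one.2 hε)
      _ ≤ 1 := by rw [mul_one]; exact two_mul_mul_stepScale_le_one hκ
  have hlength : stepScale κ / 2 * (√ε)⁻¹ ≤ m s * h := by
    calc stepScale κ / 2 * (√ε)⁻¹ = (√ε ^ 2)⁻¹ * (stepScale κ * √ε / 2) := by field_simp
      _ = m s * (stepScale κ * √ε / 2) := by rw [Real.sq_sqrt hε0.le, hms]
      _ ≤ m s * h := by have := hτ.pos s; gcongr
  refine (hX.integral_norm_sq_sub_le_energyConst_mul hV hτ hb hM hs hx₀ hh hκh (by positivity)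
    hlength hm x).trans ?_
  have : Nonempty S := ⟨x⟩
  have := (hb.energyConst_pos hM).le
  unfold averagingError
  gcongr
  exact hle.trans (mul_le_of_le_one_left hsqrt.le (stepScale_le_one κ))

end Energy

section GradientFlow

variable {S Ω : Type*} [TopologicalSpace S] {K : ℕ} {f : EuclideanSpace ℝ (Fin K) → S → ℝ}
    {κ : ℝ}

theorem IsGradientProcess.isDrivenProcess [MeasurableSpace S] [mΩ : MeasurableSpace Ω]
    {𝓕 : Filtration ℝ≥0 mΩ} {P : Kernel S Ω} {V : ℝ≥0 → Ω → S} {τ : ℝ≥0 → ℝ≥0} {m : ℝ → ℝ}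
    {θ₀ : EuclideanSpace ℝ (Fin K)} {ξ : ℝ≥0 → Ω → EuclideanSpace ℝ (Fin K)}
    (hξ : IsGradientProcess 𝓕 V f τ θ₀ ξ) (hV : IsFellerProcess 𝓕 P V) (hτ : IsTimeChange τ m) :
    IsDrivenProcess 𝓕 V (gradθ f) τ θ₀ ξ where
  adapted := hξ.adapted
  isDrivenPath ω :=
    { rightCont := fun t => (hV.cadlag ω _).1.comp (f := fun r : ℝ => τ r.toNNReal)
        (hτ.continuous.comp continuous_real_toNNReal).continuousWithinAt
        fun _ hr => hτ.monotone (Real.toNNReal_mono hr)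
      cont := (hξ.cont ω).comp continuous_real_toNNReal
      eqn := fun t ht => by rw [hξ.eqn ω t.toNNReal, Real.coe_toNNReal t ht] }

theorem UniformlyStronglyConvex.exists_isDissipativeAt [CompactSpace S] (hκ : 0 < κ)
    (hconv : UniformlyStronglyConvex f κ)
    (hgrad : Continuous fun p : EuclideanSpace ℝ (Fin K) × S => gradθ f p.1 p.2)
    (c : EuclideanSpace ℝ (Fin K)) : ∃ B, IsDissipativeAt (gradθ f) c κ B := by
  obtain ⟨B, -, hB⟩ := exists_norm_le_of_continuous (hgrad.comp (Continuous.prodMk_right c))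
  exact ⟨B, hgrad, hκ, fun x y => hconv y x c, hB⟩

theorem exists_forall_norm_le_of_mem_closedBall {E F : Type*} [NormedAddCommGroup E]
    [ProperSpace E] [NormedAddCommGroup F] [CompactSpace S] {b : E → S → F}
    (hb : Continuous fun p : E × S => b p.1 p.2) (c : E) (A : ℝ) :
    ∃ M, ∀ x, ‖x - c‖ ≤ A → ∀ y, ‖b x y‖ ≤ M := by
  obtain ⟨M, hM⟩ := ((isCompact_closedBall c A).prod isCompact_univ).exists_bound_of_continuousOn
    hb.continuousOn
  exact ⟨M, fun x hx y => hM (x, y) ⟨mem_closedBall_iff_norm.2 hx, Set.mem_univ y⟩⟩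

theorem eq_of_add_norm_sq_sub_le {E : Type*} [NormedAddCommGroup E] {Φ : E → ℝ} {x y : E}
    (hκ : 0 < κ) (hx : Φ x + κ / 2 * ‖y - x‖ ^ 2 ≤ Φ y) (hy : Φ y ≤ Φ x) : y = x := by
  have hsq : ‖y - x‖ ^ 2 ≤ 0 := nonpos_of_mul_nonpos_right (by linarith) (half_pos hκ)
  simpa [sub_eq_zero] using hsq.antisymm (sq_nonneg _)

end GradientFlow

section LearningRate

theorem eventually_exp_neg_mul_mul_le {κ : ℝ} (hκ : 0 < κ) (D : ℝ) {η : ℝ} (hη : 0 < η) :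
    ∀ᶠ t in atTop, Real.exp (-κ * t) * D ≤ η := by
  have hexp : Tendsto (fun t => Real.exp (-κ * t)) atTop (𝓝 0) :=
    Real.tendsto_exp_atBot.comp (tendsto_id.const_mul_atTop_of_neg (neg_lt_zero.2 hκ))
  simpa using (hexp.mul_const D).eventually_le_const (by simpa using hη)

theorem isTimeChange_const {ε : ℝ} (hε : 0 < ε) :
    IsTimeChange (fun t => t / ε.toNNReal) fun _ => ε⁻¹ where
  cont := continuous_const
  pos _ := inv_pos.2 hε
  mono := monotone_const
  coe_eq t := by simp [hε.le, div_eq_mul_inv]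

variable {μ : ℝ → ℝ}

theorem RateAssumption.isTimeChange (hμ : RateAssumption μ) :
    IsTimeChange (rescaledTime μ) fun r => μ (max r 0) where
  cont := hμ.contDiff.continuousOn.comp_continuous (continuous_id.max continuous_const)
    fun r => le_max_right r 0
  pos r := hμ.pos _ (le_max_right _ _)
  mono _ _ h := hμ.mono (Set.mem_Ici.2 (le_max_right _ _))
    (Set.mem_Ici.2 (le_max_right _ _)) (max_le_max_right 0 h)
  coe_eq t := by
    rw [rescaledTime, Real.coe_toNNReal _
      (intervalIntegral.integral_nonneg t.coe_nonneg fun r hr => (hμ.pos r hr.1).le)]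
    refine intervalIntegral.integral_congr fun r hr => ?_
    rw [Set.uIcc_of_le t.coe_nonneg] at hr
    simp only [max_eq_left hr.1]

theorem RateAssumption.increment_nonneg (hμ : RateAssumption μ) {t : ℝ} (ht : 0 < t) :
    0 ≤ (μ t - μ (t / 2)) / μ t :=
  div_nonneg (sub_nonneg.2 (hμ.mono (half_pos ht).le ht.le (half_le_self ht.le)))
    (hμ.pos t ht.le).le

theorem RateAssumption.le_two_mul_half (hμ : RateAssumption μ) {t : ℝ} (ht : 0 < t)
    (hincr : (μ t - μ (t / 2)) / μ t ≤ 1 / 2) : μ t ≤ 2 * μ (t / 2) := by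
  rw [div_le_iff₀ (hμ.pos t ht.le)] at hincr
  linarith

theorem RateAssumption.sub_div_half_le (hμ : RateAssumption μ) {t : ℝ} (ht : 0 < t)
    (hincr : (μ t - μ (t / 2)) / μ t ≤ 1 / 2) :
    (μ t - μ (t / 2)) / μ (t / 2) ≤ 2 * ((μ t - μ (t / 2)) / μ t) := by
  have hinc : 0 ≤ μ t - μ (t / 2) :=
    sub_nonneg.2 (hμ.mono (half_pos ht).le ht.le (half_le_self ht.le))
  have hpos := hμ.pos t ht.le
  calc (μ t - μ (t / 2)) / μ (t / 2) ≤ (μ t - μ (t / 2)) / (μ t / 2) := by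
        gcongr
        linarith [hμ.le_two_mul_half ht hincr]
    _ = 2 * ((μ t - μ (t / 2)) / μ t) := by field_simp

theorem RateAssumption.exists_increment_le (hμ : RateAssumption μ) {t : ℝ} (ht : 0 < t) :
    ∃ r ∈ Set.Ioo (t / 2) t,
      (μ t - μ (t / 2)) / μ t ≤ derivWithin μ (Set.Ici 0) r * r / μ r := by
  have hhalf : 0 < t / 2 := half_pos ht
  have hnhds : ∀ r ∈ Set.Ioo (t / 2) t, Set.Ici (0 : ℝ) ∈ 𝓝 r := fun r hr =>
    Ici_mem_nhds (hhalf.trans hr.1)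
  obtain ⟨r, hr, hslope⟩ := exists_deriv_eq_slope μ (half_lt_self ht)
    (hμ.contDiff.continuousOn.mono fun r hr => hhalf.le.trans hr.1) fun r hr =>
      ((hμ.contDiff.differentiableOn one_ne_zero r (hhalf.le.trans hr.1.le)).differentiableAt
        (hnhds r hr)).differentiableWithinAt
  have hr0 : 0 < r := hhalf.trans hr.1
  have hinc : 0 ≤ μ t - μ (t / 2) :=
    sub_nonneg.2 (hμ.mono hhalf.le ht.le (half_le_self ht.le))
  refine ⟨r, hr, div_le_div₀ ?_ ?_ (hμ.pos r hr0.le) (hμ.mono hr0.le ht.le hr.2.le)⟩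
  all_goals rw [derivWithin_of_mem_nhds (hnhds r hr), hslope, sub_half]
  · positivity
  · rw [div_mul_eq_mul_div, le_div_iff₀ hhalf]
    exact mul_le_mul_of_nonneg_left hr.1.le hinc

theorem RateAssumption.tendsto_increment (hμ : RateAssumption μ) :
    Tendsto (fun t => (μ t - μ (t / 2)) / μ t) atTop (𝓝 0) := by
  rw [Metric.tendsto_atTop]
  intro ε hε
  obtain ⟨T, hT⟩ := eventually_atTop.1 (hμ.slow.eventually_lt_const hε)
  refine ⟨max (2 * T) 1, fun t ht => ?_⟩
  have hone : 1 ≤ t := (le_max_right _ _).trans ht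
  have hhalf : T ≤ t / 2 := by linarith [(le_max_left (2 * T) 1).trans ht]
  obtain ⟨r, hr, hle⟩ := hμ.exists_increment_le (one_pos.trans_le hone)
  rw [Real.dist_0_eq_abs, abs_of_nonneg (hμ.increment_nonneg (by linarith))]
  exact hle.trans_lt (hT r (hhalf.trans hr.1.le))

theorem RateAssumption.tendsto_one_div (hμ : RateAssumption μ) :
    Tendsto (fun t => 1 / μ (t / 2)) atTop (𝓝[>] 0) := by
  simp only [one_div]
  exact tendsto_inv_atTop_nhdsGT_zero.comp
    (hμ.tendsto.comp (tendsto_id.atTop_div_const two_pos))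

theorem RateAssumption.tendsto_rateA {ρ : ℝ → ℝ} (hμ : RateAssumption μ) {κ : ℝ} (hκ : 0 < κ)
    (hρ : Tendsto ρ (𝓝[>] 0) (𝓝 0)) : Tendsto (rateA κ μ ρ) atTop (𝓝 0) := by
  have hexp : Tendsto (fun t : ℝ => Real.exp (-κ * t / 8)) atTop (𝓝 0) :=
    Real.tendsto_exp_atBot.comp ((tendsto_id.const_mul_atTop_of_neg
      (neg_lt_zero.2 hκ)).atBot_div_const (by norm_num))
  have hsum := (hexp.add hμ.tendsto_increment.sqrt).add (hρ.comp hμ.tendsto_one_div)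
  rwa [Real.sqrt_zero, add_zero, add_zero] at hsum

end LearningRate

section AveragingError

variable {S Ω E : Type*} [MeasurableSpace S] [mΩ : MeasurableSpace Ω] [NormedAddCommGroup E]
    [NormedSpace ℝ E] {P : Kernel S Ω} {V : ℝ≥0 → Ω → S} {G : S → E}

theorem averagingError_nonneg (κ ε : ℝ) : 0 ≤ averagingError P V G κ ε :=
  add_nonneg (Real.sqrt_nonneg _) (averagingModulus_nonneg _)

theorem averagingError_pos (κ : ℝ) {ε : ℝ} (hε : 0 < ε) : 0 < averagingError P V G κ ε :=
  add_pos_of_pos_of_nonneg (Real.sqrt_pos.2 hε) (averagingModulus_nonneg _)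

theorem IsFellerProcess.tendsto_averagingError [TopologicalSpace S] [CompactSpace S]
    [T2Space S] [TopologicalSpace.PseudoMetrizableSpace S] [BorelSpace S] [FiniteDimensional ℝ E]
    {𝓕 : Filtration ℝ≥0 mΩ} (hV : IsFellerProcess 𝓕 P V) {π : Measure S} [IsProbabilityMeasure π]
    (huniq : ∀ ν, IsInvariantFor P V ν → ν = π) (hG : Continuous G)
    (hmean : ∫ y, G y ∂π = 0) {κ : ℝ} (hκ : 0 < κ) :
    Tendsto (averagingError P V G κ) (𝓝[>] 0) (𝓝 0) := by
  have hsqrt : Tendsto Real.sqrt (𝓝[>] 0) (𝓝[>] 0) :=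
    tendsto_nhdsWithin_iff.2
      ⟨(Real.continuous_sqrt.tendsto' 0 0 Real.sqrt_zero).mono_left nhdsWithin_le_nhds,
        eventually_nhdsWithin_of_forall fun _ hε => Real.sqrt_pos.2 hε⟩
  have hwindow := (tendsto_inv_nhdsGT_zero.comp hsqrt).const_mul_atTop
    (half_pos (stepScale_pos hκ))
  have hsum := (hsqrt.mono_right nhdsWithin_le_nhds).add
    ((hV.tendsto_averagingModulus huniq hG hmean).comp hwindow)
  rwa [add_zero] at hsum

end AveragingError

section LongTime

variable {S Ω E : Type*} [TopologicalSpace S] [CompactSpace S]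
    [TopologicalSpace.PseudoMetrizableSpace S] [MeasurableSpace S] [BorelSpace S]
    [mΩ : MeasurableSpace Ω] [NormedAddCommGroup E] [InnerProductSpace ℝ E]
    [SecondCountableTopology E] [CompleteSpace E] [MeasurableSpace E] [BorelSpace E]
    {𝓕 : Filtration ℝ≥0 mΩ} {P : Kernel S Ω} {V : ℝ≥0 → Ω → S} {b : E → S → E} {c : E} {κ B M : ℝ}

theorem IsFellerProcess.exists_integral_norm_sq_sub_le_add (hV : IsFellerProcess 𝓕 P V)
    (hb : IsDissipativeAt b c κ B) (hM : ∀ x, ‖x - c‖ ≤ absorbingRadius κ B → ∀ y, ‖b x y‖ ≤ M)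
    {ε : ℝ} (hε : ε ∈ Set.Ioo 0 1) (N : ℝ) {η : ℝ} (hη : 0 < η) :
    ∃ t : ℝ≥0, ∀ x₀ X, ‖x₀ - c‖ ≤ N → IsDrivenProcess 𝓕 V b (fun t => t / ε.toNNReal) x₀ X →
      ∀ x, Integrable (fun ω => ‖X t ω - c‖ ^ 2) (P x) ∧
        ∫ ω, ‖X t ω - c‖ ^ 2 ∂(P x) ≤
          energyConst κ B M * averagingError P V (b c) κ ε + η := by
  have := hV.isProb
  have hκ := hb.pos
  obtain ⟨s, hinit, hs⟩ :=
    ((eventually_exp_neg_mul_mul_le hκ (N ^ 2) one_pos).and (eventually_ge_atTop 0)).exists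
  obtain ⟨a, hdecay, ha⟩ := ((eventually_exp_neg_mul_mul_le (mul_pos two_pos hκ)
    (energyConst κ B M) hη).and (eventually_ge_atTop (stepScale κ * √ε))).exists
  refine ⟨(s + a).toNNReal, fun x₀ X hN hX x => ?_⟩
  have hx₀ : Real.exp (-κ * s) * ‖x₀ - c‖ ^ 2 ≤ 1 := le_trans (by gcongr) hinit
  have hsa : s ≤ s + a := le_add_of_nonneg_right
    ((mul_nonneg (stepScale_pos hκ).le (Real.sqrt_nonneg ε)).trans ha)
  refine ⟨hX.integrable_norm_sq_sub hb hs hx₀ hsa (P x), ?_⟩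
  have henergy := hX.integral_norm_sq_sub_le hV (isTimeChange_const hε.1) hb hM hs hx₀ rfl
    hε.2.le ha (by linarith [inv_pos.2 hε.1]) x
  rw [sub_self, zero_div, add_zero, mul_add, neg_mul] at henergy
  linarith

theorem RateAssumption.eventually_integral_norm_sq_sub_le {μ : ℝ → ℝ} (hμ : RateAssumption μ)
    (hV : IsFellerProcess 𝓕 P V) (hb : IsDissipativeAt b c κ B)
    (hM : ∀ x, ‖x - c‖ ≤ absorbingRadius κ B → ∀ y, ‖b x y‖ ≤ M) (x₀ : E) :
    ∀ᶠ t : ℝ in atTop, ∀ X, IsDrivenProcess 𝓕 V b (rescaledTime μ) x₀ X → ∀ x,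
      Integrable (fun ω => ‖X t.toNNReal ω - c‖ ^ 2) (P x) ∧
        ∫ ω, ‖X t.toNNReal ω - c‖ ^ 2 ∂(P x) ≤ 2 * energyConst κ B M *
          (Real.exp (-κ * t) + (μ t - μ (t / 2)) / μ t +
            averagingError P V (b c) κ (1 / μ (t / 2))) := by
  have := hV.isProb
  have hκ := hb.pos
  have hhalf : Tendsto (fun t : ℝ => t / 2) atTop atTop := tendsto_id.atTop_div_const two_pos
  filter_upwards [hhalf.eventually (eventually_exp_neg_mul_mul_le hκ (‖x₀ - c‖ ^ 2) one_pos),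
    eventually_ge_atTop 2, (hμ.tendsto.comp hhalf).eventually_ge_atTop 1,
    hμ.tendsto_increment.eventually_le_const one_half_pos] with t hx₀ ht hone hincr X hX x
  have ht0 : 0 ≤ t / 2 := by linarith
  have htpos : 0 < t := by linarith
  refine ⟨hX.integrable_norm_sq_sub hb ht0 hx₀ (by linarith) (P x), ?_⟩
  have hms : μ (max (t / 2) 0) = μ (t / 2) := by rw [max_eq_left ht0]
  have hmt : μ (max (t / 2 + t / 2) 0) = μ t := by rw [add_halves, max_eq_left htpos.le]
  have hε : 1 / μ (t / 2) ≤ 1 := (div_le_one (hμ.pos _ ht0)).2 hone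
  have hlength : stepScale κ * √(1 / μ (t / 2)) ≤ t / 2 :=
    (mul_le_one₀ (stepScale_le_one κ) (Real.sqrt_nonneg _) (Real.sqrt_le_one.2 hε)).trans
      (by linarith)
  have henergy := hX.integral_norm_sq_sub_le hV hμ.isTimeChange hb hM ht0 hx₀
    (by rw [hms, one_div, inv_inv]) hε hlength
    (by rw [hms, hmt]; exact hμ.le_two_mul_half htpos hincr) x
  rw [hms, hmt, add_halves] at henergy
  have hratio := hμ.sub_div_half_le htpos hincr
  have : Nonempty S := ⟨x⟩
  have hexp : Real.exp (-2 * κ * (t / 2)) = Real.exp (-κ * t) := by ring_nf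
  have herr : 0 ≤ averagingError P V (b c) κ (1 / μ (t / 2)) := averagingError_nonneg _ _
  refine henergy.trans ?_
  rw [hexp, mul_comm 2, mul_assoc]
  refine mul_le_mul_of_nonneg_left ?_ (hb.energyConst_pos hM).le
  linarith [Real.exp_pos (-κ * t)]

end LongTime

section Wasserstein

theorem measure_lt_norm_sub_le {Ω E : Type*} [MeasurableSpace Ω] [NormedAddCommGroup E]
    {Q : Measure Ω} [IsFiniteMeasure Q] {X : Ω → E} {c : E} {D r : ℝ}
    (hi : Integrable (fun ω => ‖X ω - c‖ ^ 2) Q) (hD : ∫ ω, ‖X ω - c‖ ^ 2 ∂Q ≤ D) (hr : 0 < r) :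
    Q {ω | r < ‖X ω - c‖} ≤ ENNReal.ofReal (D / r ^ 2) := by
  have hmarkov := mul_meas_ge_le_integral_of_nonneg
    (Eventually.of_forall fun ω => sq_nonneg ‖X ω - c‖) hi (r ^ 2)
  have hsubset : {ω | r < ‖X ω - c‖} ⊆ {ω | r ^ 2 ≤ ‖X ω - c‖ ^ 2} := fun ω hω =>
    pow_le_pow_left₀ hr.le (le_of_lt hω) 2
  refine (measure_mono hsubset).trans ?_
  rw [← ofReal_measureReal]
  refine ENNReal.ofReal_le_ofReal ?_
  rw [le_div_iff₀' (by positivity)]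
  exact hmarkov.trans hD

theorem tendsto_measure_lt_norm_sub {E : Type*} [NormedAddCommGroup E] [CompleteSpace E]
    [SecondCountableTopology E] [MeasurableSpace E] [BorelSpace E] (ν : Measure E)
    [IsFiniteMeasure ν] (c : E) : Tendsto (fun N : ℝ => ν {y | N < ‖y - c‖}) atTop (𝓝 0) := by
  have htight := tendsto_measure_norm_gt_of_isTightMeasureSet
    (isTightMeasureSet_singleton (μ := ν.map (· - c)))
  simp only [Set.mem_singleton_iff, iSup_iSup_eq_left] at htight
  refine htight.congr fun N => ?_
  rw [Measure.map_apply (measurable_sub_const c) (measurableSet_lt measurable_const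
    measurable_norm), Set.preimage_ofPred_eq]

theorem integral_le_sqrt_integral_sq {Ω : Type*} [MeasurableSpace Ω] {Q : Measure Ω}
    [IsProbabilityMeasure Q] {X : Ω → ℝ} (hX : MemLp X 2 Q) :
    ∫ ω, X ω ∂Q ≤ √(∫ ω, X ω ^ 2 ∂Q) := by
  refine Real.le_sqrt_of_sq_le ?_
  simpa [variance_eq_sub hX] using variance_nonneg X Q

theorem lintegral_min_one_norm_le_sqrt {Ω E : Type*} [MeasurableSpace Ω] [NormedAddCommGroup E]
    {Q : Measure Ω} [IsProbabilityMeasure Q] {X : Ω → E} (hX : AEStronglyMeasurable X Q)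
    (hi : Integrable (fun ω => ‖X ω‖ ^ 2) Q) :
    ∫⁻ ω, ENNReal.ofReal (min 1 ‖X ω‖) ∂Q ≤ ENNReal.ofReal √(∫ ω, ‖X ω‖ ^ 2 ∂Q) := by
  have hmem : MemLp (fun ω => ‖X ω‖) 2 Q := (memLp_two_iff_integrable_sq hX.norm).2 hi
  calc ∫⁻ ω, ENNReal.ofReal (min 1 ‖X ω‖) ∂Q ≤ ∫⁻ ω, ENNReal.ofReal ‖X ω‖ ∂Q :=
        lintegral_mono fun ω => ENNReal.ofReal_le_ofReal (min_le_right _ _)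
    _ = ENNReal.ofReal (∫ ω, ‖X ω‖ ∂Q) :=
        (ofReal_integral_eq_lintegral_ofReal (hmem.integrable one_le_two)
          (Eventually.of_forall fun ω => norm_nonneg _)).symm
    _ ≤ ENNReal.ofReal √(∫ ω, ‖X ω‖ ^ 2 ∂Q) :=
        ENNReal.ofReal_le_ofReal (integral_le_sqrt_integral_sq hmem)

theorem lintegral_min_one_norm_le_add_measure {Ω E : Type*} [MeasurableSpace Ω]
    [NormedAddCommGroup E] (Q : Measure Ω) [IsProbabilityMeasure Q] (X : Ω → E) (r : ℝ) :
    ∫⁻ ω, ENNReal.ofReal (min 1 ‖X ω‖) ∂Q ≤ ENNReal.ofReal r + Q {ω | r < ‖X ω‖} := by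
  calc ∫⁻ ω, ENNReal.ofReal (min 1 ‖X ω‖) ∂Q
      ≤ ∫⁻ ω, (ENNReal.ofReal r + {ω | r < ‖X ω‖}.indicator 1 ω) ∂Q := by
        refine lintegral_mono fun ω => ?_
        by_cases hω : r < ‖X ω‖
        · simp [Set.indicator_of_mem (show ω ∈ {ω | r < ‖X ω‖} from hω), le_add_left]
        · exact le_add_right
            (ENNReal.ofReal_le_ofReal ((min_le_right _ _).trans (not_lt.1 hω)))
    _ ≤ ENNReal.ofReal r + Q {ω | r < ‖X ω‖} := by
        rw [lintegral_add_left measurable_const, lintegral_const, measure_univ, mul_one]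
        gcongr
        exact lintegral_indicator_one_le _

variable {K : ℕ}

theorem wasserstein_dirac_le (ν : Measure (EuclideanSpace ℝ (Fin K))) [IsProbabilityMeasure ν]
    (c : EuclideanSpace ℝ (Fin K)) :
    wasserstein ν (Measure.dirac c) ≤ ∫⁻ y, ENNReal.ofReal (min 1 ‖y - c‖) ∂ν := by
  refine (iInf₂_le (ν.prod (Measure.dirac c)) ⟨inferInstance, by simp, by simp⟩).trans
    (le_of_eq ?_)
  rw [lintegral_prod _ (Measurable.aemeasurable (by fun_prop))]
  exact lintegral_congr fun y => lintegral_dirac' _ (by fun_prop)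

theorem wasserstein_dirac_le_one (ν : Measure (EuclideanSpace ℝ (Fin K)))
    [IsProbabilityMeasure ν] (c : EuclideanSpace ℝ (Fin K)) :
    wasserstein ν (Measure.dirac c) ≤ 1 :=
  calc wasserstein ν (Measure.dirac c) ≤ ∫⁻ y, ENNReal.ofReal (min 1 ‖y - c‖) ∂ν :=
        wasserstein_dirac_le ν c
    _ ≤ ∫⁻ _, 1 ∂ν := lintegral_mono fun y => by
        rw [ENNReal.ofReal_le_one]
        exact min_le_left _ _
    _ = 1 := by simp

theorem lawFrom_dirac {S Ω : Type*} [MeasurableSpace S] [MeasurableSpace Ω] (P : Kernel S Ω)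
    (a : S) : lawFrom P (Measure.dirac a) = P a :=
  Measure.dirac_bind P.measurable a

theorem wasserstein_map_lawFrom_dirac_le {S Ω : Type*} [MeasurableSpace S] [MeasurableSpace Ω]
    {P : Kernel S Ω} [IsMarkovKernel P] (ν : Measure S) [IsProbabilityMeasure ν]
    {X : Ω → EuclideanSpace ℝ (Fin K)} (hX : Measurable X) {c : EuclideanSpace ℝ (Fin K)} {D : ℝ}
    (hD : ∀ x, Integrable (fun ω => ‖X ω - c‖ ^ 2) (P x) ∧ ∫ ω, ‖X ω - c‖ ^ 2 ∂(P x) ≤ D) :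
    wasserstein ((lawFrom P ν).map X) (Measure.dirac c) ≤ ENNReal.ofReal √D := by
  have := isProbabilityMeasure_lawFrom P ν
  have := Measure.isProbabilityMeasure_map (μ := lawFrom P ν) hX.aemeasurable
  calc wasserstein ((lawFrom P ν).map X) (Measure.dirac c)
      ≤ ∫⁻ y, ENNReal.ofReal (min 1 ‖y - c‖) ∂((lawFrom P ν).map X) := wasserstein_dirac_le _ c
    _ = ∫⁻ x, ∫⁻ ω, ENNReal.ofReal (min 1 ‖X ω - c‖) ∂(P x) ∂ν := by
        rw [lintegral_map (by fun_prop) hX, lawFrom, Measure.lintegral_bind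
          P.measurable.aemeasurable (Measurable.aemeasurable (by fun_prop))]
    _ ≤ ∫⁻ _, ENNReal.ofReal √D ∂ν := lintegral_mono fun x =>
        (lintegral_min_one_norm_le_sqrt (hX.sub_const c).aestronglyMeasurable (hD x).1).trans
          (ENNReal.ofReal_le_ofReal (Real.sqrt_le_sqrt (hD x).2))
    _ = ENNReal.ofReal √D := by simp

end Wasserstein

section ConcentrationRate

/-- The bound for the Wasserstein distance to a Dirac measure obtained from Chebyshev's inequality
when the mean-square distance is at most `C * e`: the radius `r = e ^ (1 / 3)` balances `r` against
the tail `C * e / r ^ 2`. -/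
def concentrationRate (C e : ℝ) : ℝ :=
  min 1 ((1 + C) * e ^ (1 / 3 : ℝ))

variable {C e : ℝ}

theorem concentrationRate_nonneg (hC : 0 ≤ C) (he : 0 ≤ e) : 0 ≤ concentrationRate C e :=
  le_min zero_le_one (by positivity)

theorem concentrationRate_le_one (C e : ℝ) : concentrationRate C e ≤ 1 :=
  min_le_left _ _

theorem tendsto_concentrationRate {ι : Type*} {l : Filter ι} {e : ι → ℝ} (C : ℝ)
    (he : Tendsto e l (𝓝 0)) : Tendsto (fun i => concentrationRate C (e i)) l (𝓝 0) := by
  have hpow : Tendsto (fun i => e i ^ (1 / 3 : ℝ)) l (𝓝 0) := by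
    simpa using he.rpow_const (p := 1 / 3) (Or.inr (by norm_num))
  simpa [concentrationRate] using (tendsto_const_nhds (x := (1 : ℝ))).min (hpow.const_mul (1 + C))

theorem sqrt_le_concentrationRate (hC : 0 ≤ C) (he : 0 ≤ e) (he1 : e ≤ 1) :
    √e ≤ concentrationRate C e := by
  refine le_min (Real.sqrt_le_one.2 he1) ?_
  calc √e = e ^ (1 / 2 : ℝ) := Real.sqrt_eq_rpow e
    _ ≤ e ^ (1 / 3 : ℝ) :=
      Real.rpow_le_rpow_of_exponent_ge_of_imp he he1 (by norm_num) (by norm_num)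
    _ ≤ (1 + C) * e ^ (1 / 3 : ℝ) :=
      le_mul_of_one_le_left (Real.rpow_nonneg he _) (by linarith)

theorem wasserstein_dirac_le_concentrationRate {K : ℕ} {ν : Measure (EuclideanSpace ℝ (Fin K))}
    [IsProbabilityMeasure ν] {c : EuclideanSpace ℝ (Fin K)} (hC : 0 ≤ C) (he : 0 < e)
    (hν : ∀ r > 0, ν {y | r < ‖y - c‖} ≤ ENNReal.ofReal (C * e / r ^ 2)) :
    wasserstein ν (Measure.dirac c) ≤ ENNReal.ofReal (concentrationRate C e) := by
  rw [concentrationRate, ENNReal.ofReal_min]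
  refine le_min (by simpa using wasserstein_dirac_le_one ν c) ?_
  have hr : 0 < e ^ (1 / 3 : ℝ) := Real.rpow_pos_of_pos he _
  set r := e ^ (1 / 3 : ℝ) with hr_def
  have hcube : r ^ 3 = e := by
    rw [hr_def, ← Real.rpow_natCast, ← Real.rpow_mul he.le]
    norm_num
  calc wasserstein ν (Measure.dirac c) ≤ ∫⁻ y, ENNReal.ofReal (min 1 ‖y - c‖) ∂ν :=
        wasserstein_dirac_le ν c
    _ ≤ ENNReal.ofReal r + ν {y | r < ‖y - c‖} := lintegral_min_one_norm_le_add_measure _ _ r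
    _ ≤ ENNReal.ofReal r + ENNReal.ofReal (C * e / r ^ 2) := by gcongr; exact hν r hr
    _ = ENNReal.ofReal ((1 + C) * r) := by
        rw [← ENNReal.ofReal_add hr.le (by positivity), ← hcube]
        congr 1
        field_simp

end ConcentrationRate

section Stationary

variable {S Ω : Type*} [MeasurableSpace S] [mΩ : MeasurableSpace Ω] {K : ℕ}
    {𝓕 : Filtration ℝ≥0 mΩ} {P : Kernel S Ω} [IsMarkovKernel P] {V : ℝ≥0 → Ω → S}
    {f : EuclideanSpace ℝ (Fin K) → S → ℝ} {ε : ℝ}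
    {Pst : Measure (EuclideanSpace ℝ (Fin K) × S)} {c : EuclideanSpace ℝ (Fin K)}

theorem IsStationarySGPC.measure_lt_norm_sub_le_add (hst : IsStationarySGPC 𝓕 P V f ε Pst)
    {t : ℝ≥0} {N D r : ℝ}
    (hD : ∀ θ₀ θ, ‖θ₀ - c‖ ≤ N → IsSGPC 𝓕 V f ε θ₀ θ → ∀ x,
      Integrable (fun ω => ‖θ t ω - c‖ ^ 2) (P x) ∧ ∫ ω, ‖θ t ω - c‖ ^ 2 ∂(P x) ≤ D)
    (hr : 0 < r) :
    Pst.map Prod.fst {y | r < ‖y - c‖} ≤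
      Pst.map Prod.fst {y | N < ‖y - c‖} + ENNReal.ofReal (D / r ^ 2) := by
  obtain ⟨hprob, θ, hθ, hinv⟩ := hst
  have hmeas (a : ℝ) : MeasurableSet {y : EuclideanSpace ℝ (Fin K) | a < ‖y - c‖} :=
    measurableSet_lt measurable_const (by fun_prop)
  rw [Measure.map_apply measurable_fst (hmeas r), Measure.map_apply measurable_fst (hmeas N),
    hinv t _ (measurable_fst (hmeas r))]
  calc ∫⁻ z, P z.2 {ω | r < ‖θ z.1 t ω - c‖} ∂Pst
      ≤ ∫⁻ z, ((Prod.fst ⁻¹' {y | N < ‖y - c‖}).indicator 1 z +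
          ENNReal.ofReal (D / r ^ 2)) ∂Pst := by
        refine lintegral_mono fun z => ?_
        by_cases hz : N < ‖z.1 - c‖
        · rw [Set.indicator_of_mem (by exact hz)]
          exact le_add_right prob_le_one
        · obtain ⟨hi, hle⟩ := hD z.1 (θ z.1) (not_lt.1 hz) (hθ z.1) z.2
          exact le_add_left (measure_lt_norm_sub_le hi hle hr)
    _ = Pst (Prod.fst ⁻¹' {y | N < ‖y - c‖}) + ENNReal.ofReal (D / r ^ 2) := by
        rw [lintegral_add_right _ measurable_const, lintegral_const, measure_univ, mul_one,
          lintegral_indicator_one (measurable_fst (hmeas N))]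

theorem IsStationarySGPC.measure_lt_norm_sub_le (hst : IsStationarySGPC 𝓕 P V f ε Pst) {D r : ℝ}
    (hD : ∀ N, ∀ η > 0, ∃ t : ℝ≥0, ∀ θ₀ θ, ‖θ₀ - c‖ ≤ N → IsSGPC 𝓕 V f ε θ₀ θ → ∀ x,
      Integrable (fun ω => ‖θ t ω - c‖ ^ 2) (P x) ∧ ∫ ω, ‖θ t ω - c‖ ^ 2 ∂(P x) ≤ D + η)
    (hr : 0 < r) :
    Pst.map Prod.fst {y | r < ‖y - c‖} ≤ ENNReal.ofReal (D / r ^ 2) := by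
  have hprob := hst.1
  have htail := (tendsto_measure_lt_norm_sub (Pst.map Prod.fst) c).comp
    tendsto_natCast_atTop_atTop
  have hη : Tendsto (fun n : ℕ => ENNReal.ofReal ((D + 1 / ((n : ℝ) + 1)) / r ^ 2)) atTop
      (𝓝 (ENNReal.ofReal (D / r ^ 2))) := by
    have := ((tendsto_one_div_add_atTop_nhds_zero_nat (𝕜 := ℝ)).const_add D).div_const (r ^ 2)
    rw [add_zero] at this
    exact ENNReal.tendsto_ofReal this
  have hlim := htail.add hη
  rw [zero_add] at hlim
  refine ge_of_tendsto' hlim fun n => ?_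
  obtain ⟨t, ht⟩ := hD n (1 / ((n : ℝ) + 1)) (by positivity)
  exact hst.measure_lt_norm_sub_le_add ht hr

end Stationary

section LongTimeBounds

variable {S Ω : Type*} [TopologicalSpace S] [CompactSpace S]
    [TopologicalSpace.PseudoMetrizableSpace S] [MeasurableSpace S] [BorelSpace S]
    [mΩ : MeasurableSpace Ω] {K : ℕ} {𝓕 : Filtration ℝ≥0 mΩ} {P : Kernel S Ω} {V : ℝ≥0 → Ω → S}
    {f : EuclideanSpace ℝ (Fin K) → S → ℝ} {c : EuclideanSpace ℝ (Fin K)} {κ B M : ℝ}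

theorem IsStationarySGPC.wasserstein_map_fst_dirac_le (hV : IsFellerProcess 𝓕 P V)
    (hb : IsDissipativeAt (gradθ f) c κ B)
    (hM : ∀ x, ‖x - c‖ ≤ absorbingRadius κ B → ∀ y, ‖gradθ f x y‖ ≤ M) {ε : ℝ}
    (hε : ε ∈ Set.Ioo 0 1) {Pst : Measure (EuclideanSpace ℝ (Fin K) × S)}
    (hst : IsStationarySGPC 𝓕 P V f ε Pst) :
    wasserstein (Pst.map Prod.fst) (Measure.dirac c) ≤ ENNReal.ofReal
      (concentrationRate (energyConst κ B M) (averagingError P V (gradθ f c) κ ε)) := by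
  have := hV.isProb
  have := hst.1
  have := Measure.isProbabilityMeasure_map (μ := Pst) measurable_fst.aemeasurable
  have : Nonempty S := Pst.nonempty_of_neZero.map Prod.snd
  refine wasserstein_dirac_le_concentrationRate (hb.energyConst_pos hM).le
    (averagingError_pos κ hε.1) fun r hr => hst.measure_lt_norm_sub_le (fun N η hη => ?_) hr
  obtain ⟨t, ht⟩ := hV.exists_integral_norm_sq_sub_le_add hb hM hε N hη
  exact ⟨t, fun θ₀ θ hθ₀ hθ =>
    ht θ₀ θ hθ₀ (IsGradientProcess.isDrivenProcess hθ hV (isTimeChange_const hε.1))⟩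

theorem sqrt_add_le_sqrt_add_sqrt {a b : ℝ} (ha : 0 ≤ a) (hb : 0 ≤ b) : √(a + b) ≤ √a + √b := by
  simpa only [Real.sqrt_eq_rpow] using
    Real.rpow_add_le_add_rpow ha hb one_half_pos.le one_half_lt_one.le

theorem sqrt_add_add_le_rateA {μ ρ : ℝ → ℝ} {t e : ℝ} (hκ : 0 ≤ κ) (ht : 0 ≤ t)
    (hincr : 0 ≤ (μ t - μ (t / 2)) / μ t) (he : 0 ≤ e) (hρ : √e ≤ ρ (1 / μ (t / 2))) :
    √(Real.exp (-κ * t) + (μ t - μ (t / 2)) / μ t + e) ≤ rateA κ μ ρ t := by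
  have hexp : √(Real.exp (-κ * t)) ≤ Real.exp (-κ * t / 8) := by
    rw [← Real.exp_half, Real.exp_le_exp]
    nlinarith
  calc √(Real.exp (-κ * t) + (μ t - μ (t / 2)) / μ t + e)
      ≤ √(Real.exp (-κ * t)) + √((μ t - μ (t / 2)) / μ t) + √e :=
        (sqrt_add_le_sqrt_add_sqrt (by positivity) he).trans
          (by gcongr; exact sqrt_add_le_sqrt_add_sqrt (by positivity) hincr)
    _ ≤ rateA κ μ ρ t := add_le_add (add_le_add_left hexp _) hρ

theorem RateAssumption.eventually_wasserstein_map_lawFrom_dirac_le {μ : ℝ → ℝ}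
    (hμ : RateAssumption μ) (hV : IsFellerProcess 𝓕 P V) (hb : IsDissipativeAt (gradθ f) c κ B)
    (hM : ∀ x, ‖x - c‖ ≤ absorbingRadius κ B → ∀ y, ‖gradθ f x y‖ ≤ M)
    (herr : Tendsto (averagingError P V (gradθ f c) κ) (𝓝[>] 0) (𝓝 0))
    (θ₀ : EuclideanSpace ℝ (Fin K)) :
    ∀ᶠ t : ℝ in atTop, ∀ ξ, IsSGPD 𝓕 V f μ θ₀ ξ → ∀ (ν : Measure S) [IsProbabilityMeasure ν],
      wasserstein ((lawFrom P ν).map (ξ t.toNNReal)) (Measure.dirac c) ≤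
        ENNReal.ofReal (√(2 * energyConst κ B M) * rateA κ μ (fun ε =>
          concentrationRate (energyConst κ B M) (averagingError P V (gradθ f c) κ ε)) t) := by
  have := hV.isProb
  filter_upwards [hμ.eventually_integral_norm_sq_sub_le hV hb hM θ₀, eventually_gt_atTop 0,
    (herr.comp hμ.tendsto_one_div).eventually_le_const one_pos] with t henergy ht herr1 ξ hξ ν _
  have : Nonempty S := ν.nonempty_of_neZero
  have hX := IsGradientProcess.isDrivenProcess hξ hV hμ.isTimeChange
  have herr0 := averagingError_nonneg (P := P) (V := V) (G := gradθ f c) κ (1 / μ (t / 2))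
  refine (wasserstein_map_lawFrom_dirac_le ν (hX.measurable _) (henergy ξ hX)).trans
    (ENNReal.ofReal_le_ofReal ?_)
  rw [Real.sqrt_mul (mul_pos two_pos (hb.energyConst_pos hM)).le]
  gcongr
  exact sqrt_add_add_le_rateA hb.pos.le ht.le (hμ.increment_nonneg ht) herr0
    (sqrt_le_concentrationRate (hb.energyConst_pos hM).le herr0 herr1)

end LongTimeBounds

end SGP

end

theorem mainTheorem3_general {S Ω : Type*} [TopologicalSpace S] [CompactSpace S] [T2Space S]
    [TopologicalSpace.PseudoMetrizableSpace S] [MeasurableSpace S] [BorelSpace S]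
    [mΩ : MeasurableSpace Ω] {K : ℕ} {𝓕 : Filtration ℝ≥0 mΩ} {P : Kernel S Ω} {V : ℝ≥0 → Ω → S}
    (hV : SGP.IsFellerProcess 𝓕 P V) {π : Measure S} [IsProbabilityMeasure π]
    (huniq : ∀ ν, SGP.IsInvariantFor P V ν → ν = π) {f : EuclideanSpace ℝ (Fin K) → S → ℝ}
    (hf : Continuous fun p : EuclideanSpace ℝ (Fin K) × S => f p.1 p.2)
    (hdiff : ∀ y, Differentiable ℝ fun θ => f θ y)
    (hgrad : Continuous fun p : EuclideanSpace ℝ (Fin K) × S => SGP.gradθ f p.1 p.2)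
    {κ : ℝ} (hκ : 0 < κ) (hconv : SGP.UniformlyStronglyConvex f κ) :
    ∃ θstar : EuclideanSpace ℝ (Fin K),
      (∀ θ, SGP.fullTarget f π θstar ≤ SGP.fullTarget f π θ) ∧
      (∀ θ', (∀ θ, SGP.fullTarget f π θ' ≤ SGP.fullTarget f π θ) → θ' = θstar) ∧
      ∃ ρ : ℝ → ℝ,
        (∀ ε ∈ Set.Ioo (0 : ℝ) 1, ρ ε ∈ Set.Icc (0 : ℝ) 1) ∧
        Tendsto ρ (𝓝[>] 0) (𝓝 0) ∧
        (∀ ε ∈ Set.Ioo (0 : ℝ) 1, ∀ Pst : Measure (EuclideanSpace ℝ (Fin K) × S),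
          SGP.IsStationarySGPC 𝓕 P V f ε Pst →
          SGP.wasserstein (Pst.map Prod.fst) (Measure.dirac θstar) ≤ ENNReal.ofReal (ρ ε)) ∧
        ∀ μ : ℝ → ℝ, SGP.RateAssumption μ →
          Tendsto (SGP.rateA κ μ ρ) atTop (𝓝 0) ∧
          ∀ θ₀ : EuclideanSpace ℝ (Fin K), ∃ C > (0 : ℝ),
            ∀ ξ : ℝ≥0 → Ω → EuclideanSpace ℝ (Fin K), SGP.IsSGPD 𝓕 V f μ θ₀ ξ →
            ∀ a : S, ∃ T > (0 : ℝ), ∀ t : ℝ≥0, T < t →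
              SGP.wasserstein ((SGP.lawFrom P π).map (ξ t)) (Measure.dirac θstar)
                ≤ ENNReal.ofReal (C * SGP.rateA κ μ ρ t) ∧
              SGP.wasserstein ((P a).map (ξ t)) (Measure.dirac θstar)
                ≤ ENNReal.ofReal (C * SGP.rateA κ μ ρ t) := by
  have : Nonempty S := π.nonempty_of_neZero
  obtain ⟨θstar, hcrit, hmin⟩ := hconv.exists_minimizer (π := π) hκ hf hdiff hgrad
  obtain ⟨B, hb⟩ := hconv.exists_isDissipativeAt hκ hgrad θstar
  obtain ⟨M, hM⟩ := SGP.exists_forall_norm_le_of_mem_closedBall hgrad θstar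
    (SGP.absorbingRadius κ B)
  have hC := hb.energyConst_pos hM
  have herr := hV.tendsto_averagingError huniq (hgrad.comp (Continuous.prodMk_right θstar))
    hcrit hκ
  have hρ := SGP.tendsto_concentrationRate (SGP.energyConst κ B M) herr
  refine ⟨θstar, fun θ => (le_add_of_nonneg_right (by positivity)).trans (hmin θ),
    fun θ' hθ' => SGP.eq_of_add_norm_sq_sub_le hκ (hmin θ') (hθ' θstar), _,
    fun ε _ => ⟨SGP.concentrationRate_nonneg hC.le (SGP.averagingError_nonneg κ ε),
      SGP.concentrationRate_le_one _ _⟩, hρ,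
    fun ε hε Pst hst => hst.wasserstein_map_fst_dirac_le hV hb hM hε,
    fun μ hμ => ⟨hμ.tendsto_rateA hκ hρ, fun θ₀ => ⟨√(2 * SGP.energyConst κ B M),
      by positivity, fun ξ hξ a => ?_⟩⟩⟩
  obtain ⟨T, hT⟩ := eventually_atTop.1
    (hμ.eventually_wasserstein_map_lawFrom_dirac_le hV hb hM herr θ₀)
  refine ⟨max T 1, by positivity, fun t ht => ?_⟩
  have hbound := hT t ((le_max_left T 1).trans ht.le) ξ hξ
  rw [Real.toNNReal_coe] at hbound
  exact ⟨hbound π, SGP.lawFrom_dirac P a ▸ hbound (Measure.dirac a)⟩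

theorem mainTheorem3 {S : Type u} {Ω : Type v} [TopologicalSpace S] [PolishSpace S]
    [CompactSpace S] [MeasurableSpace S] [BorelSpace S] [mΩ : MeasurableSpace Ω] {K : ℕ}
    (𝓕 : Filtration ℝ≥0 mΩ) (P : Kernel S Ω) (V : ℝ≥0 → Ω → S) (π : Measure S)
    (hV : SGP.IndexProcessAssumption.{u, v, w} 𝓕 P V π)
    (f : EuclideanSpace ℝ (Fin K) → S → ℝ) (hf : SGP.TargetAssumption f π)
    (κ : ℝ) (hκ : 0 < κ) (hconv : SGP.UniformlyStronglyConvex f κ) :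
    ∃ θstar : EuclideanSpace ℝ (Fin K),
      -- `θstar` is the unique minimizer of the full target function
      (∀ θ, SGP.fullTarget f π θstar ≤ SGP.fullTarget f π θ) ∧
      (∀ θ', (∀ θ, SGP.fullTarget f π θ' ≤ SGP.fullTarget f π θ) → θ' = θstar) ∧
      -- `ρ` depends only on the index process and on `f`
      ∃ ρ : ℝ → ℝ,
        (∀ ε ∈ Set.Ioo (0 : ℝ) 1, ρ ε ∈ Set.Icc (0 : ℝ) 1) ∧
        Tendsto ρ (𝓝[>] 0) (𝓝 0) ∧
        (∀ ε ∈ Set.Ioo (0 : ℝ) 1, ∀ Pst : Measure (EuclideanSpace ℝ (Fin K) × S),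
          SGP.IsStationarySGPC 𝓕 P V f ε Pst →
          SGP.wasserstein (Pst.map Prod.fst) (Measure.dirac θstar) ≤ ENNReal.ofReal (ρ ε)) ∧
        ∀ μ : ℝ → ℝ, SGP.RateAssumption μ →
          Tendsto (SGP.rateA κ μ ρ) atTop (𝓝 0) ∧
          ∀ θ₀ : EuclideanSpace ℝ (Fin K), ∃ C > (0 : ℝ),
            ∀ ξ : ℝ≥0 → Ω → EuclideanSpace ℝ (Fin K), SGP.IsSGPD 𝓕 V f μ θ₀ ξ →
            ∀ a : S, ∃ T > (0 : ℝ), ∀ t : ℝ≥0, T < t →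
              SGP.wasserstein ((SGP.lawFrom P π).map (ξ t)) (Measure.dirac θstar)
                ≤ ENNReal.ofReal (C * SGP.rateA κ μ ρ t) ∧
              SGP.wasserstein ((P a).map (ξ t)) (Measure.dirac θstar)
                ≤ ENNReal.ofReal (C * SGP.rateA κ μ ρ t) := by
  have := hV.invariant.1
  exact mainTheorem3_general hV.feller hV.unique hf.cont
    (fun y => (hf.contDiff y).differentiable two_ne_zero) hf.cont_grad hκ hconv
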